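/- Let $\sigma(x)=\max(x,0)$ act entrywise, let $d\le D$ and $m$ be non-negative integers, $X=[0,1]^d$, $\mu$ a probability measure on $X$, $\|g\|=\left(\int_X|g|^2\,d\mu\right)^{1/2}$, and let $\mathbf V\in\mathbb R^{D\times d}$ be the identity $I_d$ on top of a zero block. For vectors and matrices, $|\cdot|$ is the entrywise absolute value; $\|\cdot\|_2$ is the Euclidean norm, $\|\cdot\|_1$ the $\ell_1$ norm, $\|\cdot\|_{1,1}$ the sum of the absolute values of the entries of a matrix, and $\mathbf e$ is the all-one vector in $\mathbb R^D$. **Representations.** Let $\alpha\in\mathbb R^D$ and let $\rho_t$, $t\in[0,1]$, be Borel probability measures on $\mathbb R^{D\times m}\times\mathbb R^{m\times D}$. We write $f=f_{\alpha,\{\rho_t\}}$ if for every $x\in X$ the equation $z(x,0)=\mathbf Vx$, $\dot z(x,t)=\mathbb E_{(U,W)\sim\rho_t}U\sigma(Wz(x,t))$ has a unique solution on $[0,1]$ and $f(x)=\alpha^Tz(x,1)$. For $p\ge1$ let $N_p$ solve $N_p(0)=\mathbf e$, $\dot N_p(t)=\left(\mathbb E_{\rho_t}(|U||W|)^p\right)^{1/p}N_p(t)$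 (entrywise powers), and put $$\|f\|_{\tilde{\mathcal D}_p(\alpha,\{\rho_t\})}=|\alpha|^TN_p(1)+\|N_p(1)\|_1-D,$$ which counts as finite if the coefficient matrix is finite for almost every $t$ and integrable on $[0,1]$. Both differential equations are understood in integrated form. Let $\|f\|_{\tilde{\mathcal D}_p}$ be the infimum of these numbers over all $(\alpha,\{\rho_t\})$ with $f=f_{\alpha,\{\rho_t\}}$, and let $\tilde{\mathcal D}_p$ be the set of continuous functions on $X$ for which it is finite. **Lipschitz norm.** Let $\mathrm{Lip}_{\{\rho_t\}}$ be the infimum of all $K$ such that for all $t,s\in[0,1]$ and $z\in\mathbb R^D$ $$\left\|\mathbb E_{\rho_t}U\sigma(Wz)-\mathbb E_{\rho_s}U\sigma(Wz)\right\|_2\le K|t-s|\,\|z\|_2,\qquad \left|\,\left\|\mathbb E_{\rho_t}|U||W|\right\|_{1,1}-\left\|\mathbb E_{\rho_s}|U||W|\right\|_{1,1}\right|\le K|t-s|$$ ($+\infty$ if there is no such $K$, or if $\mathbb E_{\rho_t}|U||W|$ is infinite for some $t$), and let $\|\{\rho_t\}\|_{\mathrm{Lip}}=\left\|\mathbb E_{\rho_0}|U||W|\right\|_{1,1}+\mathrm{Lip}_{\{\rho_t\}}$.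 **Residual networks.** An $L$-layer residual network with parameters $\Theta=(\alpha,(U_l,W_l)_{0\le l<L})$ is $f_L(x;\Theta)=\alpha^Tz_{L,L}(x)$, where $z_{0,L}(x)=\mathbf Vx$ and $z_{l+1,L}(x)=z_{l,L}(x)+\frac1LU_l\sigma(W_lz_{l,L}(x))$. Its path norm is $$\|\Theta\|_P=|\alpha|^T\left(I+\tfrac1L|U_{L-1}||W_{L-1}|\right)\cdots\left(I+\tfrac1L|U_0||W_0|\right)\mathbf e.$$ **Theorem.** For every $\delta\in(0,1)$ there is a real polynomial $P$ in four variables, depending only on $\delta$, such that the following holds for all $d\le D$, $m$ and $\mu$ as above. Let $f\in\tilde{\mathcal D}_2$, and assume that there is a constant $l_0\ge 0$ such that for every $\varepsilon>0$ there is a pair $(\alpha,\{\rho_t\})$ with $f=f_{\alpha,\{\rho_t\}}$, $\|f\|_{\tilde{\mathcal D}_1(\alpha,\{\rho_t\})}<\|f\|_{\tilde{\mathcal D}_1}+\varepsilon$ and $\|\{\rho_t\}\|_{\mathrm{Lip}}\le l_0$. Then for every natural number $L\ge L_0:=P\left(D,m,l_0,\|f\|_{\tilde{\mathcal D}_1}\right)$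 there is an $L$-layer residual network $f_L(\cdot;\Theta)$ with $$\|f-f_L(\cdot;\Theta)\|^2\le\frac{3\|f\|_{\tilde{\mathcal D}_1}^2}{L^{1-\delta}}\qquad\text{and}\qquad\|\Theta\|_P\le9\|f\|_{\tilde{\mathcal D}_1}.$$ -/

import Mathlib

open MeasureTheory Set
open scoped NNReal ENNReal Matrix

noncomputable section

namespace CompSpace

/-- The domain `X = [0,1]^d`. -/
abbrev Cube (d : ℕ) : Type := ↥(Set.Icc (0 : Fin d → ℝ) 1)

/-- The `L²(μ)` norm of a function on `X`. -/
def l2Norm {d : ℕ} (μ : Measure (Cube d)) (f : Cube d → ℝ) : ℝ :=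
  Real.sqrt (∫ x, |f x| ^ 2 ∂μ)

/-- The Euclidean norm of a vector. -/
def eNorm {n : ℕ} (v : Fin n → ℝ) : ℝ := Real.sqrt (∑ i, v i ^ 2)

/-- The ReLU activation `σ(x) = max(x,0)`, applied entrywise. -/
def relu {n : ℕ} (v : Fin n → ℝ) : Fin n → ℝ := fun i => max (v i) 0

/-- The entrywise absolute value of a vector. -/
def absVec {n : ℕ} (v : Fin n → ℝ) : Fin n → ℝ := fun i => |v i|

/-- The fixed input matrix `V`: the `d × d` identity on top of a `(D - d) × d` zero block. -/
def inputMatrix (d D : ℕ) : Matrix (Fin D) (Fin d) ℝ :=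
  Matrix.of fun i j => if (i : ℕ) = (j : ℕ) then 1 else 0

/-- The weights `(U, W) ∈ ℝ^{D×m} × ℝ^{m×D}` of one layer, as arrays of entries; the measurable
structure is the Borel one. -/
abbrev Weights (D m : ℕ) : Type := (Fin D → Fin m → ℝ) × (Fin m → Fin D → ℝ)

/-- The vector `U σ(W z)`. -/
def layer {D m : ℕ} (w : Weights D m) (z : Fin D → ℝ) : Fin D → ℝ :=
  Matrix.of w.1 *ᵥ relu (Matrix.of w.2 *ᵥ z)

/-- The matrix `|U| |W|`, with entrywise absolute values. -/
def absProd {D m : ℕ} (w : Weights D m) : Matrix (Fin D) (Fin D) ℝ :=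
  (Matrix.of w.1).map (fun a => |a|) * (Matrix.of w.2).map (fun a => |a|)

/-- The vector `𝔼_ρ U σ(W z)`. -/
def drift {D m : ℕ} (ρ : Measure (Weights D m)) (z : Fin D → ℝ) : Fin D → ℝ :=
  fun i => ∫ w, layer w z i ∂ρ

/-- The matrix `(𝔼_ρ (|U||W|)^p)^{1/p}`, with entrywise powers. -/
def momentMatrix {D m : ℕ} (p : ℝ) (ρ : Measure (Weights D m)) : Matrix (Fin D) (Fin D) ℝ :=
  Matrix.of fun i j => (∫ w, (absProd w i j) ^ p ∂ρ) ^ (1 / p)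

/-- `z` solves `z(0) = V x`, `ż(t) = 𝔼_{ρ_t} U σ(W z(t))` on `[0,1]`, in the integrated
(Carathéodory) sense. -/
structure IsStateSolution {d D m : ℕ} (ρ : ℝ → Measure (Weights D m)) (x : Fin d → ℝ)
    (z : ℝ → Fin D → ℝ) : Prop where
  integrable_layer : ∀ᵐ t ∂(volume.restrict (Set.Icc (0 : ℝ) 1)),
    ∀ i, Integrable (fun w => layer w (z t) i) (ρ t)
  integrable_drift : ∀ i, IntervalIntegrable (fun t => drift (ρ t) (z t) i) volume 0 1
  eq_integral : ∀ t ∈ Set.Icc (0 : ℝ) 1, ∀ i,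
    z t i = (inputMatrix d D *ᵥ x) i + ∫ s in (0 : ℝ)..t, drift (ρ s) (z s) i

/-- `N` solves `N(0) = e`, `Ṅ(t) = (𝔼_{ρ_t} (|U||W|)^p)^{1/p} N(t)` on `[0,1]`, in the integrated
(Carathéodory) sense, with coefficients that are finite for almost every `t` and integrable
in `t`. -/
structure IsNormSolution {D m : ℕ} (p : ℝ) (ρ : ℝ → Measure (Weights D m))
    (N : ℝ → Fin D → ℝ) : Prop where
  integrable_moment : ∀ᵐ t ∂(volume.restrict (Set.Icc (0 : ℝ) 1)),
    ∀ i j, Integrable (fun w => (absProd w i j) ^ p) (ρ t)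
  integrable_coeff : ∀ i j, IntervalIntegrable (fun t => momentMatrix p (ρ t) i j) volume 0 1
  continuousOn : ContinuousOn N (Set.Icc 0 1)
  eq_integral : ∀ t ∈ Set.Icc (0 : ℝ) 1, ∀ i,
    N t i = 1 + ∫ s in (0 : ℝ)..t, (momentMatrix p (ρ s) *ᵥ N s) i

/-- `f = f_{α,{ρ_t}}` on `X`: each `ρ_t` is a probability distribution, the state equation has a
unique solution `z(x,·)` on `[0,1]`, and `f(x) = αᵀ z(x,1)`. -/
def Represents {d D m : ℕ} (f : Cube d → ℝ) (α : Fin D → ℝ)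
    (ρ : ℝ → Measure (Weights D m)) : Prop :=
  (∀ t ∈ Set.Icc (0 : ℝ) 1, IsProbabilityMeasure (ρ t)) ∧
  ∀ x : Cube d, ∃ z : ℝ → Fin D → ℝ, IsStateSolution ρ x.1 z ∧
    (∀ z' : ℝ → Fin D → ℝ, IsStateSolution ρ x.1 z' → Set.EqOn z' z (Set.Icc 0 1)) ∧
    f x = α ⬝ᵥ z 1

/-- The number `c` is the (finite) norm `|α|ᵀ N_p(1) + ‖N_p(1)‖₁ - D` with respect to the pair
`(α, {ρ_t})`. -/
def IsTildeNormAt {D m : ℕ} (p : ℝ) (α : Fin D → ℝ) (ρ : ℝ → Measure (Weights D m))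
    (c : ℝ) : Prop :=
  ∃ N : ℝ → Fin D → ℝ, IsNormSolution p ρ N ∧
    c = absVec α ⬝ᵥ N 1 + ∑ i, |N 1 i| - (D : ℝ)

/-- The `D̃_p` norm of `f`, for the given `D` and `m`: the infimum of the norms of `f` with respect
to the pairs that represent `f` (pairs whose norm is infinite do not contribute). -/
def tildeNorm (D m : ℕ) (p : ℝ) {d : ℕ} (f : Cube d → ℝ) : ℝ :=
  sInf {c : ℝ | ∃ (α : Fin D → ℝ) (ρ : ℝ → Measure (Weights D m)),
    Represents f α ρ ∧ IsTildeNormAt p α ρ c}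

/-- The space `D̃_p`: the continuous functions on `X` that have a representation of finite `D̃_p`
norm. -/
def tildeSpace (d D m : ℕ) (p : ℝ) : Set (Cube d → ℝ) :=
  {f | Continuous f ∧ ∃ (α : Fin D → ℝ) (ρ : ℝ → Measure (Weights D m)) (c : ℝ),
    Represents f α ρ ∧ IsTildeNormAt p α ρ c}

/-- `‖𝔼_ρ |U||W|‖_{1,1}`, the sum of the absolute values of the entries. -/
def meanMass {D m : ℕ} (ρ : Measure (Weights D m)) : ℝ :=
  ∑ i, ∑ j, |∫ w, absProd w i j ∂ρ|

/-- `K` is an admissible constant in the two Lipschitz conditions on `{ρ_t}`. -/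
structure IsLipBound {D m : ℕ} (ρ : ℝ → Measure (Weights D m)) (K : ℝ) : Prop where
  integrable : ∀ t ∈ Set.Icc (0 : ℝ) 1, ∀ i j, Integrable (fun w => absProd w i j) (ρ t)
  drift_le : ∀ t ∈ Set.Icc (0 : ℝ) 1, ∀ s ∈ Set.Icc (0 : ℝ) 1, ∀ z : Fin D → ℝ,
    eNorm (drift (ρ t) z - drift (ρ s) z) ≤ K * |t - s| * eNorm z
  mass_le : ∀ t ∈ Set.Icc (0 : ℝ) 1, ∀ s ∈ Set.Icc (0 : ℝ) 1,
    |meanMass (ρ t) - meanMass (ρ s)| ≤ K * |t - s|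

/-- The Lipschitz coefficient of `{ρ_t}`: the infimum of the admissible constants, `⊤` if there
is none. (An admissible constant is never negative.) -/
def lipCoeff {D m : ℕ} (ρ : ℝ → Measure (Weights D m)) : ℝ≥0∞ :=
  ⨅ (K : ℝ≥0) (_ : IsLipBound ρ (K : ℝ)), (K : ℝ≥0∞)

/-- The Lipschitz norm of `{ρ_t}`. -/
def lipNorm {D m : ℕ} (ρ : ℝ → Measure (Weights D m)) : ℝ≥0∞ :=
  ENNReal.ofReal (meanMass (ρ 0)) + lipCoeff ρ

/-- The parameters of an `L`-layer residual network of width `D` with `m` hidden units per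
layer. -/
structure ResNet (D m L : ℕ) where
  weights : Fin L → Weights D m
  α : Fin D → ℝ

/-- The last state `z_{L,L}(x)`, from `z_{0,L} = V x` and
`z_{l+1,L} = z_{l,L} + (1/L) U_l σ(W_l z_{l,L})` for `l = 0, …, L-1`. -/
def ResNet.state {d D m L : ℕ} (Θ : ResNet D m L) (x : Fin d → ℝ) : Fin D → ℝ :=
  Fin.foldl L (fun z l => z + (1 / (L : ℝ)) • layer (Θ.weights l) z) (inputMatrix d D *ᵥ x)

/-- The function `f_L(x; Θ) = αᵀ z_{L,L}(x)` on `X`. -/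
def ResNet.toFun {d D m L : ℕ} (Θ : ResNet D m L) (x : Cube d) : ℝ :=
  Θ.α ⬝ᵥ Θ.state x.1

/-- The `l₁` path norm `|α|ᵀ ∏_l (I + (1/L)|U_l||W_l|) e`; the factors act on the all-one vector
`e` in the order of the layers. -/
def ResNet.pathNorm {D m L : ℕ} (Θ : ResNet D m L) : ℝ :=
  absVec Θ.α ⬝ᵥ Fin.foldl L
    (fun y l => (1 + (1 / (L : ℝ)) • absProd (Θ.weights l)) *ᵥ y) (fun _ => (1 : ℝ))

end CompSpace

end

/-! The layers are drawn at random from the laws of the flow and derandomised one at a time by the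
method of conditional expectations. The controlled quantity is `potential`: the current path-norm
vector paired with the remaining products of 1 + ∫𝔼|U||W|, plus `lam` times a weighted squared L²(μ)
distance between the network state and the flow. The path-norm vector also dominates the state
entrywise.

The error weights are backward products divided by forward products. With them, weighted AM-GM
absorbs the cross terms created by a layer (`weighted_quadratic_step`), so propagating errors costs
no Gronwall exponential. This is why a polynomial depth suffices.

What remains per layer is of second order in 1/L, provided |U||W| is bounded and not merely
integrable. Positive homogeneity of ReLU gives this: `exists_reweighted` rescales U against a change
of density, keeping all means that matter. Lipschitz dependence on time makes the Euler step
consistent. Hence `exists_layer` raises the potential by at most S/L when `lam` · 725κ²M² ≤ L, and L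
layers at most double the initial bound S = 6T/5, where T is the norm of f. The first term of the
final potential bounds the path norm; Cauchy-Schwarz and the second term bound the error by
3T²/`lam`. The choice `lam` = L^(1-δ) turns the condition into 725κ²M² ≤ L^δ. -/

noncomputable section

namespace CompSpace

/-- The matrix `𝔼_ρ |U||W|`. -/
def meanAbs {D m : ℕ} (ρ : Measure (Weights D m)) : Matrix (Fin D) (Fin D) ℝ :=
  Matrix.of fun i j => ∫ w, absProd w i j ∂ρ

/-! ### Layer estimates and reweighting by homogeneity -/

section Layer

variable {D m : ℕ}

theorem absProd_apply (w : Weights D m) (i j : Fin D) :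
    absProd w i j = ∑ k, |w.1 i k| * |w.2 k j| := by
  simp [absProd, Matrix.mul_apply]

theorem absProd_nonneg (w : Weights D m) (i j : Fin D) : 0 ≤ absProd w i j := by
  rw [absProd_apply]; positivity

theorem layer_apply (w : Weights D m) (z : Fin D → ℝ) (i : Fin D) :
    layer w z i = ∑ k, w.1 i k * max (∑ j, w.2 k j * z j) 0 := by
  simp [layer, relu, Matrix.mulVec, dotProduct]

theorem abs_layer_sub_le (w : Weights D m) (z z' : Fin D → ℝ) (i : Fin D) :
    |layer w z i - layer w z' i| ≤ ∑ j, absProd w i j * |z j - z' j| := by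
  have h1 : ∀ k, |w.1 i k * max (∑ j, w.2 k j * z j) 0 - w.1 i k * max (∑ j, w.2 k j * z' j) 0|
      ≤ ∑ j, |w.1 i k| * |w.2 k j| * |z j - z' j| := by
    intro k
    rw [← mul_sub, abs_mul]
    simp only [mul_assoc]
    rw [← Finset.mul_sum]
    gcongr
    refine (abs_max_sub_max_le_abs _ _ _).trans ?_
    rw [← Finset.sum_sub_distrib]
    refine (Finset.abs_sum_le_sum_abs _ _).trans (le_of_eq ?_)
    simp only [← mul_sub, abs_mul]
  simp only [layer_apply, absProd_apply, ← Finset.sum_sub_distrib, Finset.sum_mul]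
  rw [Finset.sum_comm]
  exact (Finset.abs_sum_le_sum_abs _ _).trans (Finset.sum_le_sum fun k _ => h1 k)

theorem layer_zero_right (w : Weights D m) : layer w (0 : Fin D → ℝ) = 0 := by
  ext i; simp [layer_apply]

theorem abs_layer_le (w : Weights D m) (z : Fin D → ℝ) (i : Fin D) :
    |layer w z i| ≤ ∑ j, absProd w i j * |z j| := by
  simpa [layer_zero_right] using abs_layer_sub_le w z 0 i

theorem continuous_layer (i : Fin D) :
    Continuous fun p : Weights D m × (Fin D → ℝ) => layer p.1 p.2 i := by
  simp only [layer_apply]; fun_prop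

theorem continuous_absProd (i j : Fin D) :
    Continuous fun w : Weights D m => absProd w i j := by
  simp only [absProd_apply]; fun_prop

theorem layer_smul (c : ℝ) (w : Weights D m) (z : Fin D → ℝ) (i : Fin D) :
    layer (c • w.1, w.2) z i = c * layer w z i := by
  simp [layer_apply, Finset.mul_sum, mul_assoc]

theorem absProd_smul {c : ℝ} (hc : 0 ≤ c) (w : Weights D m) (i j : Fin D) :
    absProd (c • w.1, w.2) i j = c * absProd w i j := by
  simp [absProd_apply, Finset.mul_sum, mul_assoc, abs_mul, abs_of_nonneg hc]

variable {ρ : Measure (Weights D m)}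

theorem meanAbs_nonneg (i j : Fin D) : 0 ≤ meanAbs ρ i j :=
  integral_nonneg fun w => absProd_nonneg w i j

theorem meanMass_eq : meanMass ρ = ∑ i, ∑ j, meanAbs ρ i j :=
  Finset.sum_congr rfl fun i _ => Finset.sum_congr rfl fun j _ =>
    abs_of_nonneg (meanAbs_nonneg i j)

theorem meanMass_nonneg : 0 ≤ meanMass ρ :=
  Finset.sum_nonneg fun _ _ => Finset.sum_nonneg fun _ _ => abs_nonneg _

theorem row_le_sum {B : Matrix (Fin D) (Fin D) ℝ} (hB : ∀ i j, 0 ≤ B i j) (i : Fin D) :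
    ∑ j, B i j ≤ ∑ i, ∑ j, B i j :=
  Finset.single_le_sum (f := fun i => ∑ j, B i j)
    (fun i _ => Finset.sum_nonneg fun j _ => hB i j) (Finset.mem_univ i)

theorem row_mul_le {B : Matrix (Fin D) (Fin D) ℝ} (hB : ∀ i j, 0 ≤ B i j) {κ Z : ℝ}
    (hκ : ∑ i, ∑ j, B i j ≤ κ) (hZ0 : 0 ≤ Z) {v : Fin D → ℝ} (hv : ∀ j, v j ≤ Z) (i : Fin D) :
    ∑ j, B i j * v j ≤ κ * Z := by
  calc ∑ j, B i j * v j ≤ ∑ j, B i j * Z :=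
        Finset.sum_le_sum fun j _ => mul_le_mul_of_nonneg_left (hv j) (hB i j)
    _ = (∑ j, B i j) * Z := by rw [Finset.sum_mul]
    _ ≤ κ * Z := mul_le_mul_of_nonneg_right ((row_le_sum hB i).trans hκ) hZ0

theorem integrable_layer (h : ∀ i j, Integrable (fun w => absProd w i j) ρ)
    (z : Fin D → ℝ) (i : Fin D) : Integrable (fun w => layer w z i) ρ := by
  have h1 : Integrable (fun w => ∑ j, absProd w i j * |z j|) ρ :=
    integrable_finsetSum _ fun j _ => (h i j).mul_const _
  refine h1.mono' ?_ (ae_of_all _ fun w => abs_layer_le w z i)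
  exact ((continuous_layer i).comp (by fun_prop : Continuous fun w : Weights D m => (w, z)))
    |>.aestronglyMeasurable

theorem abs_drift_sub_le (h : ∀ i j, Integrable (fun w => absProd w i j) ρ)
    (z z' : Fin D → ℝ) (i : Fin D) :
    |drift ρ z i - drift ρ z' i| ≤ ∑ j, meanAbs ρ i j * |z j - z' j| := by
  unfold drift
  rw [← integral_sub (integrable_layer h z i) (integrable_layer h z' i)]
  refine (abs_integral_le_integral_abs).trans ?_
  have h1 : ∫ w, ∑ j, absProd w i j * |z j - z' j| ∂ρ = ∑ j, meanAbs ρ i j * |z j - z' j| := by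
    rw [integral_finsetSum _ fun j _ => (h i j).mul_const _]
    simp [integral_mul_const, meanAbs]
  rw [← h1]
  refine integral_mono
    ((integrable_layer h z i).sub (integrable_layer h z' i)).abs
    (integrable_finsetSum _ fun j _ => (h i j).mul_const _)
    fun w => abs_layer_sub_le w z z' i

theorem drift_zero_right : drift ρ (0 : Fin D → ℝ) = 0 := by
  ext i; simp [drift, layer_zero_right]

theorem abs_drift_le (h : ∀ i j, Integrable (fun w => absProd w i j) ρ)
    (z : Fin D → ℝ) (i : Fin D) :
    |drift ρ z i| ≤ ∑ j, meanAbs ρ i j * |z j| := by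
  simpa [drift_zero_right] using abs_drift_sub_le h z 0 i

/-- Positive homogeneity allows one to reweight a law so that the total mass of `|U||W|` is almost
surely constant, without changing the means of `U σ(W z)` and `|U||W|`. -/
theorem exists_reweighted [IsProbabilityMeasure ρ]
    (h : ∀ i j, Integrable (fun w => absProd w i j) ρ) :
    ∃ ν : Measure (Weights D m), IsProbabilityMeasure ν ∧
      (∀ᵐ w ∂ν, ∑ i, ∑ j, absProd w i j ≤ meanMass ρ) ∧
      meanAbs ν = meanAbs ρ ∧ ∀ z, drift ν z = drift ρ z := by
  set s : Weights D m → ℝ := fun w => ∑ i, ∑ j, absProd w i j with hs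
  have hs0 : ∀ w, 0 ≤ s w := fun w =>
    Finset.sum_nonneg fun i _ => Finset.sum_nonneg fun j _ => absProd_nonneg w i j
  have hle : ∀ w i j, absProd w i j ≤ s w := fun w i j =>
    (Finset.single_le_sum (f := fun j => absProd w i j) (fun j _ => absProd_nonneg w i j)
      (Finset.mem_univ j)).trans (row_le_sum (absProd_nonneg w) i)
  have hsc : Continuous s :=
    continuous_finsetSum _ fun i _ => continuous_finsetSum _ fun j _ => continuous_absProd i j
  have hsi : Integrable s ρ :=
    integrable_finsetSum _ fun i _ => integrable_finsetSum _ fun j _ => h i j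
  have hint : ∫ w, s w ∂ρ = meanMass ρ := by
    rw [meanMass_eq, hs, integral_finsetSum _ fun i _ => integrable_finsetSum _ fun j _ => h i j]
    refine Finset.sum_congr rfl fun i _ => ?_
    rw [integral_finsetSum _ fun j _ => h i j]
    rfl
  -- Normalising by the mean mass fails when it is zero; then all the means vanish and the Dirac
  -- mass at zero weights serves.
  rcases (meanMass_nonneg (ρ := ρ)).eq_or_lt' with hM | hM
  · have h0 : ∀ i j, meanAbs ρ i j = 0 := by
      intro i j
      refine le_antisymm ?_ (meanAbs_nonneg i j)
      rw [← hM, ← hint]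
      exact integral_mono (h i j) hsi fun w => hle w i j
    refine ⟨Measure.dirac 0, inferInstance, ?_, ?_, ?_⟩
    · rw [ae_dirac_eq]
      simp [hM, absProd_apply]
    · ext i j
      rw [h0]
      simp [meanAbs, absProd_apply]
    · intro z
      ext i
      have := abs_drift_le h z i
      simp only [h0, zero_mul, Finset.sum_const_zero] at this
      rw [abs_nonpos_iff.mp this]
      simp [drift, layer_apply]
  · set c := meanMass ρ with hc
    set g : Weights D m → ℝ≥0 := fun w => (s w / c).toNNReal with hg
    have hgm : Measurable g := (hsc.measurable.div_const c).real_toNNReal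
    have hgv : ∀ w, (g w : ℝ) = s w / c := fun w =>
      Real.coe_toNNReal _ (div_nonneg (hs0 w) hM.le)
    set Φ : Weights D m → Weights D m := fun w => ((c / s w) • w.1, w.2) with hΦ
    have hΦm : Measurable Φ := by
      have : Measurable fun w : Weights D m => c / s w := measurable_const.div hsc.measurable
      exact (this.smul measurable_fst).prodMk measurable_snd
    have hpos : ∀ w, 0 ≤ c / s w := fun w => div_nonneg hM.le (hs0 w)
    -- The density s/c cancels the scaling c/s, so every F homogeneous of degree one in U keeps its
    -- mean. Where s = 0 the convention c/0 = 0 is harmless because F vanishes there.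
    have key : ∀ (F : Weights D m → ℝ), Measurable F → (∀ w, F (Φ w) = c / s w * F w) →
        (∀ w, |F w| ≤ 0 ∨ s w ≠ 0) →
        ∫ w, F w ∂((ρ.withDensity fun w => (g w : ℝ≥0∞)).map Φ) = ∫ w, F w ∂ρ := by
      intro F hF hF1 hF2
      rw [integral_map hΦm.aemeasurable hF.aestronglyMeasurable,
        integral_withDensity_eq_integral_smul hgm]
      refine integral_congr_ae (ae_of_all _ fun w => ?_)
      simp only [NNReal.smul_def, hgv, hF1, smul_eq_mul]
      rcases hF2 w with h2 | h2
      · rw [abs_nonpos_iff.mp h2]; simp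
      · field_simp
    refine ⟨(ρ.withDensity fun w => (g w : ℝ≥0∞)).map Φ, ?_, ?_, ?_, ?_⟩
    · have : IsProbabilityMeasure (ρ.withDensity fun w => (g w : ℝ≥0∞)) := by
        constructor
        rw [withDensity_apply _ MeasurableSet.univ, Measure.restrict_univ]
        have : ∫⁻ w, (g w : ℝ≥0∞) ∂ρ = ENNReal.ofReal (∫ w, s w / c ∂ρ) := by
          rw [ofReal_integral_eq_lintegral_ofReal (hsi.div_const c)
            (ae_of_all _ fun w => div_nonneg (hs0 w) hM.le)]
          rfl
        rw [this, integral_div, hint, div_self hM.ne', ENNReal.ofReal_one]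
      exact Measure.isProbabilityMeasure_map hΦm.aemeasurable
    · refine (ae_map_iff hΦm.aemeasurable (measurableSet_le hsc.measurable measurable_const)).2
        (ae_of_all _ fun w => ?_)
      have : s (Φ w) = c / s w * s w := by
        calc s (Φ w) = ∑ i, ∑ j, c / s w * absProd w i j :=
              Finset.sum_congr rfl fun i _ => Finset.sum_congr rfl fun j _ =>
                absProd_smul (hpos w) w i j
          _ = c / s w * s w := by simp only [← Finset.mul_sum, hs]
      change s (Φ w) ≤ c
      rw [this]
      rcases eq_or_ne (s w) 0 with h0 | h0
      · rw [h0]; simpa using hM.le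
      · rw [div_mul_cancel₀ _ h0]
    · ext i j
      refine key _ (continuous_absProd i j).measurable (fun w => absProd_smul (hpos w) w i j) ?_
      intro w
      rcases eq_or_ne (s w) 0 with h0 | h0
      · left
        rw [abs_of_nonneg (absProd_nonneg w i j), ← h0]
        exact hle w i j
      · exact .inr h0
    · intro z
      ext i
      refine key _ ((continuous_layer i).comp
        (by fun_prop : Continuous fun w : Weights D m => (w, z))).measurable
        (fun w => layer_smul _ w z i) ?_
      intro w
      rcases eq_or_ne (s w) 0 with h0 | h0
      · left
        refine (abs_layer_le w z i).trans (le_of_eq ?_)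
        refine Finset.sum_eq_zero fun j _ => ?_
        rw [le_antisymm ((hle w i j).trans h0.le) (absProd_nonneg w i j), zero_mul]
      · exact .inr h0

end Layer

/-! ### Comparison for linear integral equations with nonnegative coefficients -/

section Comparison

variable {D : ℕ} {A : ℝ → Matrix (Fin D) (Fin D) ℝ}

theorem intervalIntegrable_mulVec
    (hA : ∀ i j, IntervalIntegrable (fun t => A t i j) volume 0 1) {v : ℝ → Fin D → ℝ}
    (hv : ContinuousOn v (Icc 0 1)) {a b : ℝ} (ha : a ∈ Icc (0 : ℝ) 1) (hb : b ∈ Icc (0 : ℝ) 1)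
    (i : Fin D) : IntervalIntegrable (fun t => (A t *ᵥ v t) i) volume a b := by
  have hsub : uIcc a b ⊆ Icc (0 : ℝ) 1 := ordConnected_Icc.uIcc_subset ha hb
  simp only [Matrix.mulVec, dotProduct]
  have := IntervalIntegrable.sum (μ := volume) (a := a) (b := b) Finset.univ
    (f := fun (j : Fin D) t => A t i j * v t j) fun j _ =>
      ((hA i j).mono_set (by rwa [uIcc_of_le (zero_le_one' ℝ)])).mul_continuousOn
        ((continuousOn_pi.1 hv j).mono hsub)
  simpa [Finset.sum_fn] using this

theorem mulVec_apply (B : Matrix (Fin D) (Fin D) ℝ) (v : Fin D → ℝ) (i : Fin D) :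
    (B *ᵥ v) i = ∑ j, B i j * v j := by
  simp only [Matrix.mulVec, dotProduct]

theorem mulVec_nonneg {B : Matrix (Fin D) (Fin D) ℝ} (hB : ∀ i j, 0 ≤ B i j) {v : Fin D → ℝ}
    (hv : ∀ i, 0 ≤ v i) (i : Fin D) : 0 ≤ (B *ᵥ v) i := by
  rw [mulVec_apply]
  exact Finset.sum_nonneg fun j _ => mul_nonneg (hB i j) (hv j)

theorem integral_mulVec_nonneg {v : ℝ → Fin D → ℝ} {a b : ℝ} (hab : a ≤ b)
    (hA0 : ∀ t ∈ Icc a b, ∀ i j, 0 ≤ A t i j)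
    (hv : ∀ t ∈ Icc a b, ∀ i, 0 ≤ v t i) (i : Fin D) : 0 ≤ ∫ s in a..b, (A s *ᵥ v s) i :=
  intervalIntegral.integral_nonneg hab fun s hs => mulVec_nonneg (hA0 s hs) (hv s hs) i

/-- A strict supersolution of a linear integral equation with nonnegative coefficients is
nonnegative. -/
theorem nonneg_of_supersolution (hA0 : ∀ t ∈ Icc (0 : ℝ) 1, ∀ i j, 0 ≤ A t i j)
    {v : ℝ → Fin D → ℝ} (hv : ContinuousOn v (Icc 0 1)) {η : ℝ} (hη : 0 < η)
    (h : ∀ t ∈ Icc (0 : ℝ) 1, ∀ i, η + ∫ s in (0 : ℝ)..t, (A s *ᵥ v s) i ≤ v t i) :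
    ∀ t ∈ Icc (0 : ℝ) 1, ∀ i, 0 ≤ v t i := by
  -- Nonnegativity strictly before t suffices, since the endpoint does not affect the integral.
  have hstep : ∀ t ∈ Icc (0 : ℝ) 1, (∀ s ∈ Ico 0 t, ∀ i, 0 ≤ v s i) → ∀ i, η ≤ v t i := by
    intro t ht hs i
    refine le_trans (le_add_of_nonneg_right ?_) (h t ht i)
    rw [intervalIntegral.integral_of_le ht.1, integral_Ioc_eq_integral_Ioo]
    refine setIntegral_nonneg measurableSet_Ioo fun s hs' => ?_
    exact mulVec_nonneg (hA0 s ⟨hs'.1.le, hs'.2.le.trans ht.2⟩) (hs s ⟨hs'.1.le, hs'.2⟩) i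
  by_contra hcon
  push Not at hcon
  obtain ⟨t₁, ht₁, i₁, hi₁⟩ := hcon
  -- A non-strict threshold makes the set compact, so a first such time exists. Before it v is
  -- positive, and `hstep` then forces v ≥ η at that time, a contradiction.
  set B : Set ℝ := {t | t ∈ Icc (0 : ℝ) 1 ∧ ∃ i, v t i ≤ η / 2} with hB
  have hBc : IsCompact B := by
    refine isCompact_Icc.of_isClosed_subset ?_ fun t ht => ht.1
    have : B = ⋃ i, {t | t ∈ Icc (0 : ℝ) 1 ∧ v t i ≤ η / 2} := by
      ext t; simp [hB]
    rw [this]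
    refine isClosed_iUnion_of_finite fun i => ?_
    exact isClosed_Icc.isClosed_le (continuousOn_pi.1 hv i) continuousOn_const
  obtain ⟨t₀, ht₀, hmin⟩ := hBc.exists_isLeast ⟨t₁, ht₁, i₁, by linarith⟩
  obtain ⟨i₀, hi₀⟩ := ht₀.2
  have := hstep t₀ ht₀.1 (fun s hs i => by
    by_contra hneg
    exact absurd (hmin ⟨⟨hs.1, hs.2.le.trans ht₀.1.2⟩, i, by linarith⟩) (not_le.2 hs.2)) i₀
  linarith

variable (hA0 : ∀ t ∈ Icc (0 : ℝ) 1, ∀ i j, 0 ≤ A t i j)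
  (hA : ∀ i j, IntervalIntegrable (fun t => A t i j) volume 0 1)
  {N : ℝ → Fin D → ℝ} (hN : ContinuousOn N (Icc 0 1))
  (hNe : ∀ t ∈ Icc (0 : ℝ) 1, ∀ i, N t i = 1 + ∫ s in (0 : ℝ)..t, (A s *ᵥ N s) i)

include hN hNe

include hA in
theorem solution_sub {a b : ℝ} (ha : a ∈ Icc (0 : ℝ) 1) (hb : b ∈ Icc (0 : ℝ) 1) (i : Fin D) :
    N b i = N a i + ∫ s in a..b, (A s *ᵥ N s) i := by
  have h0 : (0 : ℝ) ∈ Icc (0 : ℝ) 1 := ⟨le_rfl, zero_le_one⟩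
  rw [hNe a ha i, hNe b hb i, add_assoc, intervalIntegral.integral_add_adjacent_intervals
    (intervalIntegrable_mulVec hA hN h0 ha i) (intervalIntegrable_mulVec hA hN ha hb i)]

include hA0

theorem one_le_solution : ∀ t ∈ Icc (0 : ℝ) 1, ∀ i, 1 ≤ N t i := by
  have h0 := nonneg_of_supersolution hA0 hN one_pos fun t ht i => (hNe t ht i).ge
  intro t ht i
  rw [hNe t ht i]
  refine le_add_of_nonneg_right (integral_mulVec_nonneg ht.1 ?_ ?_ i)
  · exact fun s hs => hA0 s ⟨hs.1, hs.2.trans ht.2⟩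
  · exact fun s hs => h0 s ⟨hs.1, hs.2.trans ht.2⟩

include hA

theorem solution_mono {a b : ℝ} (ha : 0 ≤ a) (hab : a ≤ b) (hb : b ≤ 1) (i : Fin D) :
    N a i ≤ N b i := by
  rw [solution_sub hA hN hNe (a := a) (b := b) ⟨ha, hab.trans hb⟩ ⟨ha.trans hab, hb⟩]
  refine le_add_of_nonneg_right (integral_mulVec_nonneg hab ?_ ?_ i)
  · exact fun s hs => hA0 s ⟨ha.trans hs.1, hs.2.trans hb⟩
  · exact fun s hs i => zero_le_one.trans
      (one_le_solution hA0 hN hNe s ⟨ha.trans hs.1, hs.2.trans hb⟩ i)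

/-- A Grönwall estimate in which N itself replaces the exponential: (r + η)N − u is a strict
supersolution for each η > 0, and η is then sent to 0. -/
theorem subsolution_le {u : ℝ → Fin D → ℝ} (hu : ContinuousOn u (Icc 0 1)) {r : ℝ}
    (hu' : ∀ t ∈ Icc (0 : ℝ) 1, ∀ i, u t i ≤ r + ∫ s in (0 : ℝ)..t, (A s *ᵥ u s) i) :
    ∀ t ∈ Icc (0 : ℝ) 1, ∀ i, u t i ≤ r * N t i := by
  intro t ht i
  have h0 : (0 : ℝ) ∈ Icc (0 : ℝ) 1 := ⟨le_rfl, zero_le_one⟩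
  have hNp := zero_lt_one.trans_le (one_le_solution hA0 hN hNe t ht i)
  refine le_of_forall_pos_le_add fun ε hε => ?_
  set η := ε / N t i
  have hη : 0 < η := div_pos hε hNp
  have := nonneg_of_supersolution hA0 (v := fun t => (r + η) • N t - u t)
    ((hN.const_smul (r + η)).sub hu :) hη (fun t ht i => by
      have e : ∀ s, (A s *ᵥ ((r + η) • N s - u s)) i
          = (r + η) * (A s *ᵥ N s) i - (A s *ᵥ u s) i := by
        intro s; rw [Matrix.mulVec_sub, Matrix.mulVec_smul]; rfl
      simp only [e]
      rw [intervalIntegral.integral_sub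
        ((intervalIntegrable_mulVec hA hN h0 ht i).const_mul _)
        (intervalIntegrable_mulVec hA hu h0 ht i), intervalIntegral.integral_const_mul]
      have h1 := hu' t ht i
      have h2 := hNe t ht i
      simp only [Pi.sub_apply, Pi.smul_apply, smul_eq_mul]
      rw [h2]
      linarith) t ht i
  simp only [Pi.sub_apply, Pi.smul_apply, smul_eq_mul] at this
  have e : η * N t i = ε := div_mul_cancel₀ _ hNp.ne'
  nlinarith

end Comparison

/-! ### The state equation, its bounds by the norm equation, and Euler consistency -/

section State

variable {d D m : ℕ}

theorem momentMatrix_one (ρ : Measure (Weights D m)) : momentMatrix 1 ρ = meanAbs ρ := by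
  ext i j; simp [momentMatrix, meanAbs]

theorem abs_inputMatrix_mulVec_le (D : ℕ) (x : Fin d → ℝ) {r : ℝ} (hr : ∀ j, |x j| ≤ r)
    (hr0 : 0 ≤ r) (i : Fin D) : |(inputMatrix d D *ᵥ x) i| ≤ r := by
  simp only [inputMatrix, Matrix.mulVec, dotProduct, Matrix.of_apply, ite_mul, one_mul, zero_mul]
  by_cases hi : (i : ℕ) < d
  · rw [Finset.sum_eq_single (⟨i, hi⟩ : Fin d)]
    · simpa using hr _
    · intro j _ hj
      rw [if_neg fun h => hj (Fin.ext h.symm)]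
    · simp
  · rw [Finset.sum_eq_zero, abs_zero]
    · exact hr0
    · intro j _
      rw [if_neg fun h => hi (by rw [h]; exact j.2)]

theorem abs_le_eNorm (v : Fin D → ℝ) (i : Fin D) : |v i| ≤ eNorm v := by
  rw [eNorm, ← Real.sqrt_sq_eq_abs]
  exact Real.sqrt_le_sqrt
    (Finset.single_le_sum (f := fun i => v i ^ 2) (fun i _ => sq_nonneg _) (Finset.mem_univ i))

theorem eNorm_le_sum (v : Fin D → ℝ) : eNorm v ≤ ∑ i, |v i| := by
  rw [eNorm]
  refine Real.sqrt_le_iff.2 ⟨Finset.sum_nonneg fun i _ => abs_nonneg _, ?_⟩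
  simpa using Finset.sum_sq_le_sq_sum_of_nonneg (s := Finset.univ) (f := fun i => |v i|)
    fun i _ => abs_nonneg _

variable {ρ : ℝ → Measure (Weights D m)}

theorem IsStateSolution.sub_eq {x : Fin d → ℝ} {z : ℝ → Fin D → ℝ} (hz : IsStateSolution ρ x z)
    {a b : ℝ} (ha : a ∈ Icc (0 : ℝ) 1) (hb : b ∈ Icc (0 : ℝ) 1) (i : Fin D) :
    IntervalIntegrable (fun s => drift (ρ s) (z s) i) volume a b ∧
      z b i - z a i = ∫ s in a..b, drift (ρ s) (z s) i := by
  have h0 : (0 : ℝ) ∈ Icc (0 : ℝ) 1 := ⟨le_rfl, zero_le_one⟩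
  have key : ∀ {a b : ℝ}, a ∈ Icc (0 : ℝ) 1 → b ∈ Icc (0 : ℝ) 1 →
      IntervalIntegrable (fun s => drift (ρ s) (z s) i) volume a b := fun ha hb =>
    (hz.integrable_drift i).mono_set (by
      rw [uIcc_of_le (zero_le_one' ℝ)]; exact ordConnected_Icc.uIcc_subset ha hb)
  refine ⟨key ha hb, ?_⟩
  rw [hz.eq_integral a ha, hz.eq_integral b hb, add_sub_add_left_eq_sub,
    intervalIntegral.integral_interval_sub_left (key h0 hb) (key h0 ha)]

theorem IsStateSolution.continuousOn {x : Fin d → ℝ} {z : ℝ → Fin D → ℝ}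
    (hz : IsStateSolution ρ x z) : ContinuousOn z (Icc 0 1) := by
  refine continuousOn_pi.2 fun i => ?_
  have hI := (intervalIntegrable_iff_integrableOn_Icc_of_le (zero_le_one' ℝ)).1
    (hz.integrable_drift i)
  rw [← uIcc_of_le (zero_le_one' ℝ)] at hI ⊢
  have h := intervalIntegral.continuousOn_primitive_interval hI
  rw [uIcc_of_le (zero_le_one' ℝ)] at h ⊢
  exact (continuousOn_const.add h).congr fun t ht => hz.eq_integral t ht i

variable {N : ℝ → Fin D → ℝ} {κ M : ℝ}

/-- A curve of laws together with a solution of the norm equation, with uniform bounds on the mass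
of `𝔼|U||W|` and on the solution. -/
structure IsBoundedFlow (ρ : ℝ → Measure (Weights D m)) (N : ℝ → Fin D → ℝ) (κ M : ℝ) : Prop where
  isProb : ∀ t ∈ Icc (0 : ℝ) 1, IsProbabilityMeasure (ρ t)
  lip : IsLipBound ρ κ
  norm : IsNormSolution 1 ρ N
  mass_le : ∀ t ∈ Icc (0 : ℝ) 1, meanMass (ρ t) ≤ κ
  sum_le : ∑ i, N 1 i ≤ M
  one_le : 1 ≤ κ

namespace IsBoundedFlow

variable (F : IsBoundedFlow ρ N κ M)

include F

theorem coeff_integrable (i j : Fin D) :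
    IntervalIntegrable (fun t => meanAbs (ρ t) i j) volume 0 1 := by
  simpa [momentMatrix_one] using F.norm.integrable_coeff i j

theorem norm_eq : ∀ t ∈ Icc (0 : ℝ) 1, ∀ i,
    N t i = 1 + ∫ s in (0 : ℝ)..t, (meanAbs (ρ s) *ᵥ N s) i := by
  simpa [momentMatrix_one] using F.norm.eq_integral

theorem one_le_norm : ∀ t ∈ Icc (0 : ℝ) 1, ∀ i, 1 ≤ N t i :=
  one_le_solution (fun _ _ => meanAbs_nonneg) F.norm.continuousOn F.norm_eq

theorem norm_mono {a b : ℝ} (ha : 0 ≤ a) (hab : a ≤ b) (hb : b ≤ 1) (i : Fin D) :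
    N a i ≤ N b i :=
  solution_mono (fun _ _ => meanAbs_nonneg) F.coeff_integrable F.norm.continuousOn F.norm_eq
    ha hab hb i

theorem sum_norm_le {t : ℝ} (ht : t ∈ Icc (0 : ℝ) 1) : ∑ i, N t i ≤ M :=
  (Finset.sum_le_sum fun i _ => F.norm_mono ht.1 ht.2 le_rfl i).trans F.sum_le

theorem norm_le {t : ℝ} (ht : t ∈ Icc (0 : ℝ) 1) (i : Fin D) : N t i ≤ M :=
  (Finset.single_le_sum (f := fun i => N t i)
    (fun i _ => zero_le_one.trans (F.one_le_norm t ht i)) (Finset.mem_univ i)).trans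
    (F.sum_norm_le ht)

theorem bound_nonneg : 0 ≤ M :=
  (Finset.sum_nonneg fun i _ =>
    zero_le_one.trans (F.one_le_norm 1 ⟨zero_le_one, le_rfl⟩ i)).trans F.sum_le

theorem drift_sub_le {t : ℝ} (ht : t ∈ Icc (0 : ℝ) 1) (z z' : Fin D → ℝ) (i : Fin D) :
    |drift (ρ t) z i - drift (ρ t) z' i| ≤ (meanAbs (ρ t) *ᵥ fun j => |z j - z' j|) i := by
  rw [mulVec_apply]
  exact abs_drift_sub_le (F.lip.integrable t ht) z z' i

theorem drift_sub_le_of_le {t : ℝ} (ht : t ∈ Icc (0 : ℝ) 1) {z z' : Fin D → ℝ} {Z : ℝ}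
    (hZ : 0 ≤ Z) (hz : ∀ j, |z j - z' j| ≤ Z) (i : Fin D) :
    |drift (ρ t) z i - drift (ρ t) z' i| ≤ κ * Z :=
  (abs_drift_sub_le (F.lip.integrable t ht) z z' i).trans
    (row_mul_le meanAbs_nonneg (meanMass_eq (ρ := ρ t) ▸ F.mass_le t ht) hZ hz i)

theorem drift_le_of_le {t : ℝ} (ht : t ∈ Icc (0 : ℝ) 1) {z : Fin D → ℝ} {Z : ℝ}
    (hZ : 0 ≤ Z) (hz : ∀ j, |z j| ≤ Z) (i : Fin D) : |drift (ρ t) z i| ≤ κ * Z := by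
  simpa [drift_zero_right] using
    F.drift_sub_le_of_le ht (z' := 0) hZ (by simpa using hz) i

/-- The entrywise distance of two states is a subsolution of the norm equation started from r.
Comparison with the zero state bounds the flow; the general case gives continuity in the input. -/
theorem state_sub_le {x x' : Fin d → ℝ} {z z' : ℝ → Fin D → ℝ}
    (hz : IsStateSolution ρ x z) (hz' : IsStateSolution ρ x' z') {r : ℝ}
    (hr : ∀ j, |x j - x' j| ≤ r) (hr0 : 0 ≤ r) :
    ∀ t ∈ Icc (0 : ℝ) 1, ∀ i, |z t i - z' t i| ≤ r * N t i := by
  have hc : ContinuousOn (fun t i => |z t i - z' t i|) (Icc 0 1) :=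
    continuousOn_pi.2 fun i => ((continuousOn_pi.1 hz.continuousOn i).sub
      (continuousOn_pi.1 hz'.continuousOn i)).abs
  refine subsolution_le (A := fun t => meanAbs (ρ t)) (fun _ _ => meanAbs_nonneg)
    F.coeff_integrable F.norm.continuousOn F.norm_eq (u := fun t i => |z t i - z' t i|) hc ?_
  intro t ht i
  have h0 : (0 : ℝ) ∈ Icc (0 : ℝ) 1 := ⟨le_rfl, zero_le_one⟩
  rw [hz.eq_integral t ht, hz'.eq_integral t ht, add_sub_add_comm, ← Pi.sub_apply,
    ← Matrix.mulVec_sub, ← intervalIntegral.integral_sub (hz.sub_eq h0 ht i).1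
      (hz'.sub_eq h0 ht i).1]
  refine (abs_add_le _ _).trans (add_le_add
    (abs_inputMatrix_mulVec_le D _ (fun j => by simpa using hr j) hr0 i) ?_)
  rw [← Real.norm_eq_abs]
  refine intervalIntegral.norm_integral_le_of_norm_le ht.1 (ae_of_all _ fun s hs => ?_)
    (intervalIntegrable_mulVec F.coeff_integrable hc h0 ht i)
  exact F.drift_sub_le ⟨hs.1.le, hs.2.trans ht.2⟩ _ _ i

omit F in
theorem isStateSolution_zero : IsStateSolution ρ (0 : Fin d → ℝ) (0 : ℝ → Fin D → ℝ) where
  integrable_layer := by simp [layer_zero_right]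
  integrable_drift := by simp [drift_zero_right]
  eq_integral := by simp [drift_zero_right]

theorem state_le {x : Fin d → ℝ} {z : ℝ → Fin D → ℝ} (hz : IsStateSolution ρ x z)
    (hx : ∀ j, |x j| ≤ 1) : ∀ t ∈ Icc (0 : ℝ) 1, ∀ i, |z t i| ≤ N t i := by
  simpa using F.state_sub_le hz isStateSolution_zero (r := 1) (by simpa using hx) zero_le_one

theorem state_increment_le {x : Fin d → ℝ} {z : ℝ → Fin D → ℝ} (hz : IsStateSolution ρ x z)
    (hx : ∀ j, |x j| ≤ 1) {a b : ℝ} (ha : 0 ≤ a) (hab : a ≤ b) (hb : b ≤ 1) (i : Fin D) :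
    |z b i - z a i| ≤ κ * M * (b - a) := by
  rw [(hz.sub_eq ⟨ha, hab.trans hb⟩ ⟨ha.trans hab, hb⟩ i).2, ← abs_of_nonneg (sub_nonneg.2 hab),
    ← Real.norm_eq_abs]
  refine intervalIntegral.norm_integral_le_of_norm_le_const fun s hs => ?_
  rw [uIoc_of_le hab] at hs
  have hs' : s ∈ Icc (0 : ℝ) 1 := ⟨ha.trans hs.1.le, hs.2.trans hb⟩
  exact F.drift_le_of_le hs' F.bound_nonneg
    (fun j => (F.state_le hz hx s hs' j).trans (F.norm_le hs' j)) i

/-- The Euler step with the law frozen at any time of the interval is consistent. -/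
theorem euler_consistent {x : Fin d → ℝ} {z : ℝ → Fin D → ℝ} (hz : IsStateSolution ρ x z)
    (hx : ∀ j, |x j| ≤ 1) {a b t : ℝ} (ha : 0 ≤ a) (hab : a ≤ b) (hb : b ≤ 1)
    (ht : t ∈ Icc a b) (i : Fin D) :
    |(b - a) * drift (ρ t) (z a) i - (z b i - z a i)| ≤ 2 * κ ^ 2 * M * (b - a) ^ 2 := by
  have ha' : a ∈ Icc (0 : ℝ) 1 := ⟨ha, hab.trans hb⟩
  have hab' := sub_nonneg.2 hab
  have hM := F.bound_nonneg
  have hκ := F.one_le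
  obtain ⟨h1, h2⟩ := hz.sub_eq ha' ⟨ha.trans hab, hb⟩ i
  rw [h2, ← smul_eq_mul, ← intervalIntegral.integral_const,
    ← intervalIntegral.integral_sub intervalIntegrable_const h1]
  -- Moving the law from t to s costs κ(b − a)M by the Lipschitz condition; moving the state from a
  -- to s costs κ · κM(b − a). Since κ ≥ 1, both fit in 2κ²M(b − a), whichever t in the interval is
  -- used.
  have key : ∀ s ∈ uIoc a b, ‖drift (ρ t) (z a) i - drift (ρ s) (z s) i‖
      ≤ 2 * κ ^ 2 * M * (b - a) := by
    intro s hs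
    rw [uIoc_of_le hab] at hs
    have hs' : s ∈ Icc (0 : ℝ) 1 := ⟨ha.trans hs.1.le, hs.2.trans hb⟩
    have ht' : t ∈ Icc (0 : ℝ) 1 := ⟨ha.trans ht.1, ht.2.trans hb⟩
    have e1 : |drift (ρ t) (z a) i - drift (ρ s) (z a) i| ≤ κ * (b - a) * M := by
      refine (abs_le_eNorm (drift (ρ t) (z a) - drift (ρ s) (z a)) i).trans ?_
      refine (F.lip.drift_le t ht' s hs' (z a)).trans ?_
      have f1 : |t - s| ≤ b - a := abs_sub_le_of_le_of_le ht.1 ht.2 hs.1.le hs.2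
      have f2 : eNorm (z a) ≤ M := (eNorm_le_sum _).trans
        ((Finset.sum_le_sum fun j _ => F.state_le hz hx a ha' j).trans (F.sum_norm_le ha'))
      have f3 : 0 ≤ eNorm (z a) := Real.sqrt_nonneg _
      gcongr
    have e2 : |drift (ρ s) (z a) i - drift (ρ s) (z s) i| ≤ κ * (κ * M * (b - a)) := by
      refine F.drift_sub_le_of_le hs' (by positivity) (fun j => ?_) i
      rw [abs_sub_comm]
      refine (F.state_increment_le hz hx ha hs.1.le (hs.2.trans hb) j).trans ?_
      have := hs.2
      gcongr
    have e3 := abs_sub_le (drift (ρ t) (z a) i) (drift (ρ s) (z a) i) (drift (ρ s) (z s) i)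
    have e4 : κ * (b - a) * M ≤ κ ^ 2 * M * (b - a) := by
      have : κ * (M * (b - a)) ≤ κ ^ 2 * (M * (b - a)) :=
        mul_le_mul_of_nonneg_right (by nlinarith) (by positivity)
      linarith
    rw [Real.norm_eq_abs]
    linarith
  refine (intervalIntegral.norm_integral_le_of_norm_le_const key).trans (le_of_eq ?_)
  rw [abs_of_nonneg hab']; ring

end IsBoundedFlow

end State

/-! ### Discrete path-norm products and the adjoint weights -/

section DiscreteWeights

variable {D : ℕ} {A : ℕ → Matrix (Fin D) (Fin D) ℝ}

/-- The forward products `(1 + A_{l-1}) ⋯ (1 + A_0) e`. -/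
def fwd (A : ℕ → Matrix (Fin D) (Fin D) ℝ) : ℕ → Fin D → ℝ
  | 0 => fun _ => 1
  | l + 1 => fwd A l + A l *ᵥ fwd A l

/-- The backward products `pᵀ (1 + A_{L-1}) ⋯ (1 + A_{L-k})`. -/
def bwdAux (A : ℕ → Matrix (Fin D) (Fin D) ℝ) (L : ℕ) (p : Fin D → ℝ) : ℕ → Fin D → ℝ
  | 0 => p
  | k + 1 => bwdAux A L p k + bwdAux A L p k ᵥ* A (L - (k + 1))

/-- The backward products `pᵀ (1 + A_{L-1}) ⋯ (1 + A_l)`. -/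
def bwd (A : ℕ → Matrix (Fin D) (Fin D) ℝ) (L : ℕ) (p : Fin D → ℝ) (l : ℕ) : Fin D → ℝ :=
  bwdAux A L p (L - l)

theorem bwd_self (L : ℕ) (p : Fin D → ℝ) : bwd A L p L = p := by
  simp [bwd, bwdAux]

theorem bwd_eq {L l : ℕ} (h : l < L) (p : Fin D → ℝ) :
    bwd A L p l = bwd A L p (l + 1) + bwd A L p (l + 1) ᵥ* A l := by
  obtain ⟨k, rfl⟩ := Nat.exists_eq_add_of_lt h
  have e1 : l + k + 1 - l = k + 1 := by omega
  have e2 : l + k + 1 - (l + 1) = k := by omega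
  have e3 : l + k + 1 - (k + 1) = l := by omega
  simp only [bwd, e1, e2, bwdAux, e3]

theorem one_le_fwd (hA : ∀ l i j, 0 ≤ A l i j) (l : ℕ) (i : Fin D) : 1 ≤ fwd A l i := by
  induction l generalizing i with
  | zero => simp [fwd]
  | succ l ih =>
    have := mulVec_nonneg (hA l) (fun i => zero_le_one.trans (ih i)) i
    have := ih i
    simp only [fwd, Pi.add_apply]
    linarith

theorem vecMul_nonneg {B : Matrix (Fin D) (Fin D) ℝ} (hB : ∀ i j, 0 ≤ B i j) {v : Fin D → ℝ}
    (hv : ∀ i, 0 ≤ v i) (i : Fin D) : 0 ≤ (v ᵥ* B) i := by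
  simp only [Matrix.vecMul, dotProduct]
  exact Finset.sum_nonneg fun j _ => mul_nonneg (hv j) (hB j i)

theorem le_bwd (hA : ∀ l i j, 0 ≤ A l i j) {p : Fin D → ℝ} (hp : ∀ i, 0 ≤ p i) (L l : ℕ)
    (i : Fin D) : p i ≤ bwd A L p l i := by
  unfold bwd
  induction L - l generalizing i with
  | zero => exact le_rfl
  | succ k ih =>
    have := vecMul_nonneg (hA (L - (k + 1))) (fun i => (hp i).trans (ih i)) i
    have := ih i
    simp only [bwdAux, Pi.add_apply]
    linarith

/-- Each factor 1 + A_l can be moved from the backward to the forward vector. The conserved pairing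
bounds the sum of the error weights at every layer. -/
theorem bwd_dot_fwd {L : ℕ} (p : Fin D → ℝ) {l : ℕ} (hl : l ≤ L) :
    bwd A L p l ⬝ᵥ fwd A l = p ⬝ᵥ fwd A L := by
  induction hl using Nat.decreasingInduction with
  | self => rw [bwd_self]
  | of_succ k hk ih =>
    rw [← ih, bwd_eq hk, fwd, dotProduct_add, add_dotProduct, Matrix.dotProduct_mulVec]

/-- One step of the discrete adjoint identity: with the weights `ψ / φ`, the quadratic cross terms
produced by `B` are absorbed. -/
theorem weighted_quadratic_step {B : Matrix (Fin D) (Fin D) ℝ} (hB : ∀ i j, 0 ≤ B i j)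
    {ψ φ a : Fin D → ℝ} {c : Fin D → Fin D → ℝ} (hψ : ∀ i, 0 ≤ ψ i) (hφ : ∀ i, 0 < φ i)
    (ha : ∀ i, 0 ≤ a i)
    (hc : ∀ i j, 2 * c i j ≤ a i * (φ j / φ i) + a j * (φ i / φ j)) :
    ∑ i, ψ i / (φ + B *ᵥ φ) i * (a i + 2 * ∑ j, B i j * c i j)
      ≤ ∑ i, (ψ + ψ ᵥ* B) i / φ i * a i := by
  have hBφ : ∀ i, 0 ≤ (B *ᵥ φ) i := mulVec_nonneg hB fun i => (hφ i).le
  have hφ' : ∀ i, 0 < (φ + B *ᵥ φ) i := fun i => add_pos_of_pos_of_nonneg (hφ i) (hBφ i)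
  have h1 : ∀ i, ψ i / (φ + B *ᵥ φ) i * (a i + 2 * ∑ j, B i j * c i j)
      ≤ ψ i * a i / φ i + ∑ j, ψ i * B i j * (a j / φ j) := by
    intro i
    -- AM-GM with the ratios of φ splits each cross term: one part has the factor (Bφ)_i, the other
    -- is a sum of a_j/φ_j.
    have e1 : 2 * ∑ j, B i j * c i j
        ≤ a i / φ i * (B *ᵥ φ) i + φ i * ∑ j, B i j * (a j / φ j) := by
      rw [mulVec_apply, Finset.mul_sum, Finset.mul_sum, Finset.mul_sum, ← Finset.sum_add_distrib]
      refine Finset.sum_le_sum fun j _ => ?_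
      have := mul_le_mul_of_nonneg_left (hc i j) (hB i j)
      calc 2 * (B i j * c i j) = B i j * (2 * c i j) := by ring
        _ ≤ _ := this
        _ = _ := by ring
    have hs : 0 ≤ ∑ j, B i j * (a j / φ j) :=
      Finset.sum_nonneg fun j _ => mul_nonneg (hB i j) (div_nonneg (ha j) (hφ j).le)
    have e2 : φ i * ∑ j, B i j * (a j / φ j)
        ≤ (φ + B *ᵥ φ) i * ∑ j, B i j * (a j / φ j) :=
      mul_le_mul_of_nonneg_right (le_add_of_nonneg_right (hBφ i)) hs
    have e3 : a i + a i / φ i * (B *ᵥ φ) i = (φ + B *ᵥ φ) i * (a i / φ i) := by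
      have := (hφ i).ne'
      simp only [Pi.add_apply]
      field_simp
    -- The new forward weight factors out and cancels the denominator; what is left, summed against
    -- ψ, is the backward step applied to a/φ.
    have e4 : a i + 2 * ∑ j, B i j * c i j
        ≤ (φ + B *ᵥ φ) i * (a i / φ i + ∑ j, B i j * (a j / φ j)) := by
      rw [mul_add]; linarith
    calc ψ i / (φ + B *ᵥ φ) i * (a i + 2 * ∑ j, B i j * c i j)
        ≤ ψ i / (φ + B *ᵥ φ) i * ((φ + B *ᵥ φ) i * (a i / φ i + ∑ j, B i j * (a j / φ j))) :=
          mul_le_mul_of_nonneg_left e4 (div_nonneg (hψ i) (hφ' i).le)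
      _ = ψ i * (a i / φ i + ∑ j, B i j * (a j / φ j)) := by
          rw [← mul_assoc, div_mul_cancel₀ _ (hφ' i).ne']
      _ = _ := by rw [mul_add, Finset.mul_sum]; simp only [mul_assoc, mul_div_assoc]
  refine (Finset.sum_le_sum fun i _ => h1 i).trans (le_of_eq ?_)
  rw [Finset.sum_add_distrib, Finset.sum_comm, ← Finset.sum_add_distrib]
  refine Finset.sum_congr rfl fun i _ => ?_
  simp only [Pi.add_apply, Matrix.vecMul, dotProduct, ← Finset.sum_mul]
  ring

end DiscreteWeights

/-! ### Mean squared error after one random layer -/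

section RandomLayer

variable {X : Type*} [TopologicalSpace X] [CompactSpace X] [MeasurableSpace X] [BorelSpace X]
  {D m : ℕ}

theorem integrable_of_continuous {μ : Measure X} [IsFiniteMeasure μ] {g : X → ℝ}
    (hg : Continuous g) : Integrable g μ := by
  obtain ⟨C, hC⟩ := isCompact_univ.exists_bound_of_continuousOn hg.continuousOn
  exact Integrable.of_bound hg.aestronglyMeasurable C (ae_of_all _ fun x => hC x (mem_univ x))

/-- The expected squared error, in one component, after a random layer. -/
theorem expected_error_le [SecondCountableTopology X] {μ : Measure X} [IsProbabilityMeasure μ] {ν : Measure (Weights D m)}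
    [IsProbabilityMeasure ν] {κ Y E b h β : ℝ}
    (hν : ∀ᵐ w ∂ν, ∑ i, ∑ j, absProd w i j ≤ κ)
    (hνi : ∀ i j, Integrable (fun w => absProd w i j) ν)
    {z u c : X → Fin D → ℝ} (hz : Continuous z) (hu : Continuous u) (hc : Continuous c)
    (hh : 0 ≤ h) (hY : 0 ≤ Y) (huY : ∀ x i, |u x i| ≤ Y)
    (hE : ∀ x i, |u x i - z x i| ≤ E) (hcb : ∀ x i, |c x i| ≤ b)
    (hcons : ∀ x i, |h * drift ν (z x) i - c x i| ≤ β) (i : Fin D) :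
    Integrable (fun w => ∫ x, (u x i + h * layer w (u x) i - z x i - c x i) ^ 2 ∂μ) ν ∧
    ∫ w, ∫ x, (u x i + h * layer w (u x) i - z x i - c x i) ^ 2 ∂μ ∂ν
      ≤ ∫ x, (u x i - z x i) ^ 2 ∂μ
        + 2 * h * ∑ j, meanAbs ν i j * ∫ x, |u x i - z x i| * |u x j - z x j| ∂μ
        + (2 * E * β + (h * (κ * Y) + b) ^ 2) := by
  set q : Weights D m → X → ℝ := fun w x => (u x i + h * layer w (u x) i - z x i - c x i) ^ 2
    with hq
  have hlay : ∀ᵐ w ∂ν, ∀ x, |layer w (u x) i| ≤ κ * Y := by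
    filter_upwards [hν] with w hw x
    exact (abs_layer_le w (u x) i).trans (row_mul_le (absProd_nonneg w) hw hY (huY x) i)
  have hstep : ∀ᵐ w ∂ν, ∀ x, |h * layer w (u x) i - c x i| ≤ h * (κ * Y) + b := by
    filter_upwards [hlay] with w hw x
    refine (abs_sub _ _).trans (add_le_add ?_ (hcb x i))
    rw [abs_mul, abs_of_nonneg hh]
    exact mul_le_mul_of_nonneg_left (hw x) hh
  have hqc : Continuous fun p : Weights D m × X => q p.1 p.2 := by
    have h1 : Continuous fun p : Weights D m × X => layer p.1 (u p.2) i :=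
      (continuous_layer i).comp (continuous_fst.prodMk (hu.comp continuous_snd))
    have h2 : ∀ {g : X → Fin D → ℝ}, Continuous g →
        Continuous fun p : Weights D m × X => g p.2 i := fun hg =>
      (continuous_apply i).comp (hg.comp continuous_snd)
    exact ((((h2 hu).add (continuous_const.mul h1)).sub (h2 hz)).sub (h2 hc)).pow 2
  have hqi : Integrable (fun p : Weights D m × X => q p.1 p.2) (ν.prod μ) := by
    refine Integrable.of_bound hqc.aestronglyMeasurable ((E + (h * (κ * Y) + b)) ^ 2) ?_
    filter_upwards [Measure.quasiMeasurePreserving_fst.ae hstep] with p hp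
    rw [Real.norm_eq_abs, abs_of_nonneg (sq_nonneg _), hq]
    refine sq_le_sq' ?_ ?_
    all_goals
      have h1 := abs_le.1 (hp p.2)
      have h2 := abs_le.1 (hE p.2 i)
      linarith [h1.1, h1.2, h2.1, h2.2]
  have hint : ∀ (g : X → ℝ), Continuous g → Integrable g μ := fun g hg =>
    integrable_of_continuous hg
  have hu' : ∀ i, Continuous fun x => u x i := fun i => (continuous_apply i).comp hu
  have hz' : ∀ i, Continuous fun x => z x i := fun i => (continuous_apply i).comp hz
  have hcc : ∀ i j, Continuous fun x => |u x i - z x i| * |u x j - z x j| := fun i j =>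
    ((hu' i).sub (hz' i)).abs.mul ((hu' j).sub (hz' j)).abs
  refine ⟨hqi.integral_prod_left, ?_⟩
  rw [integral_integral_swap hqi]
  -- Expansion around e = u − z. The squared increment is bounded almost surely. The mean of the
  -- linear term splits into a drift difference, which yields the cross terms, and a consistency
  -- error, which costs 2Eβ.
  have hpt : ∀ x, ∫ w, q w x ∂ν ≤ (u x i - z x i) ^ 2
      + 2 * h * (∑ j, meanAbs ν i j * (|u x i - z x i| * |u x j - z x j|))
      + (2 * E * β + (h * (κ * Y) + b) ^ 2) := by
    intro x
    set e := u x i - z x i with he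
    have hli := integrable_layer hνi (u x) i
    have h1 : ∫ w, q w x ∂ν ≤ ∫ w, (e ^ 2 + (2 * e) * (h * layer w (u x) i - c x i)
        + (h * (κ * Y) + b) ^ 2) ∂ν := by
      have hI : Integrable (fun w => e ^ 2 + (2 * e) * (h * layer w (u x) i - c x i)
          + (h * (κ * Y) + b) ^ 2) ν :=
        ((integrable_const _).add (((hli.const_mul h).sub (integrable_const _)).const_mul _)).add
          (integrable_const _)
      refine integral_mono_of_nonneg (ae_of_all _ fun w => sq_nonneg _) hI ?_
      filter_upwards [hstep] with w hw
      have h2 := sq_le_sq' (abs_le.1 (hw x)).1 (abs_le.1 (hw x)).2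
      have h3 : q w x = e ^ 2 + (2 * e) * (h * layer w (u x) i - c x i)
          + (h * layer w (u x) i - c x i) ^ 2 := by
        simp only [hq, he]; ring
      rw [h3]
      linarith
    have h2 : ∫ w, (e ^ 2 + (2 * e) * (h * layer w (u x) i - c x i)
        + (h * (κ * Y) + b) ^ 2) ∂ν
        = e ^ 2 + (2 * e) * (h * drift ν (u x) i - c x i) + (h * (κ * Y) + b) ^ 2 := by
      have i1 : Integrable (fun w => (2 * e) * (h * layer w (u x) i - c x i)) ν :=
        ((hli.const_mul h).sub (integrable_const _)).const_mul _
      have i2 : Integrable (fun w => e ^ 2 + (2 * e) * (h * layer w (u x) i - c x i)) ν :=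
        (integrable_const _).add i1
      rw [integral_add i2 (integrable_const _), integral_add (integrable_const _) i1,
        integral_const_mul, integral_sub (hli.const_mul h) (integrable_const _),
        integral_const_mul]
      simp [drift]
    rw [h2] at h1
    refine h1.trans ?_
    have h3 : h * drift ν (u x) i - c x i
        = h * (drift ν (u x) i - drift ν (z x) i) + (h * drift ν (z x) i - c x i) := by ring
    have h4 : e * (drift ν (u x) i - drift ν (z x) i)
        ≤ ∑ j, meanAbs ν i j * (|e| * |u x j - z x j|) := by
      refine (le_abs_self _).trans ?_
      rw [abs_mul]
      refine (mul_le_mul_of_nonneg_left (abs_drift_sub_le hνi (u x) (z x) i)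
        (abs_nonneg e)).trans (le_of_eq ?_)
      rw [Finset.mul_sum]
      exact Finset.sum_congr rfl fun j _ => by ring
    have h5 : e * (h * drift ν (z x) i - c x i) ≤ E * β := by
      refine (le_abs_self _).trans ?_
      rw [abs_mul]
      exact mul_le_mul (hE x i) (hcons x i) (abs_nonneg _) ((abs_nonneg _).trans (hE x i))
    have h6 := mul_le_mul_of_nonneg_left h4 hh
    have h7 : 2 * e * (h * drift ν (u x) i - c x i)
        = 2 * (h * (e * (drift ν (u x) i - drift ν (z x) i)))
          + 2 * (e * (h * drift ν (z x) i - c x i)) := by ring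
    linarith
  have hR1 : Continuous fun x => ∑ j, meanAbs ν i j * (|u x i - z x i| * |u x j - z x j|) :=
    continuous_finsetSum _ fun j _ => continuous_const.mul (hcc i j)
  have hR0 : Continuous fun x => (u x i - z x i) ^ 2 := ((hu' i).sub (hz' i)).pow 2
  have hR2 : Continuous fun x => 2 * h * ∑ j, meanAbs ν i j *
      (|u x i - z x i| * |u x j - z x j|) := continuous_const.mul hR1
  have hR3 : Continuous fun x => (u x i - z x i) ^ 2 + 2 * h * ∑ j, meanAbs ν i j *
      (|u x i - z x i| * |u x j - z x j|) := hR0.add hR2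
  have hR4 : Continuous fun x => (u x i - z x i) ^ 2 + 2 * h * (∑ j, meanAbs ν i j *
      (|u x i - z x i| * |u x j - z x j|)) + (2 * E * β + (h * (κ * Y) + b) ^ 2) :=
    hR3.add continuous_const
  refine (integral_mono hqi.integral_prod_right (hint _ hR4) hpt).trans (le_of_eq ?_)
  rw [integral_add (hint _ hR3) (integrable_const _), integral_add (hint _ hR0) (hint _ hR2),
    integral_const_mul, integral_finsetSum _ fun j _ => (hint _ (hcc i j)).const_mul _]
  simp [integral_const_mul]

end RandomLayer

/-! ### Choosing one layer so that the potential hardly grows -/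

section Step

variable {d D m : ℕ}

/-- Replaces averaging the laws over a grid interval, for which measurability of t ↦ ρ_t would be
needed: only scalar functionals of the law are averaged. -/
theorem exists_le_interval_average {g : ℝ → ℝ} {a b : ℝ} (hab : a < b)
    (hg : IntervalIntegrable g volume a b) :
    ∃ t ∈ Icc a b, (b - a) * g t ≤ ∫ s in a..b, g s := by
  obtain ⟨t, ht, h⟩ := exists_le_setAverage (μ := volume) (s := Ioc a b) (f := g)
    (by simpa using hab) (by simp) hg.1
  refine ⟨t, Ioc_subset_Icc_self ht, ?_⟩
  have hba := sub_pos.2 hab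
  rw [setAverage_eq, Real.volume_real_Ioc_of_le hab.le, smul_eq_mul] at h
  rw [intervalIntegral.integral_of_le hab.le]
  calc (b - a) * g t ≤ (b - a) * ((b - a)⁻¹ * ∫ s in Ioc a b, g s) :=
        mul_le_mul_of_nonneg_left h hba.le
    _ = _ := by rw [← mul_assoc, mul_inv_cancel₀ hba.ne', one_mul]

theorem integrable_absProd_of_mass_le {ν : Measure (Weights D m)} [IsFiniteMeasure ν] {κ : ℝ}
    (hν : ∀ᵐ w ∂ν, ∑ i, ∑ j, absProd w i j ≤ κ) (i j : Fin D) :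
    Integrable (fun w => absProd w i j) ν := by
  refine Integrable.of_bound (continuous_absProd i j).aestronglyMeasurable κ ?_
  filter_upwards [hν] with w hw
  rw [Real.norm_eq_abs, abs_of_nonneg (absProd_nonneg w i j)]
  exact ((Finset.single_le_sum (f := fun j => absProd w i j) (fun j _ => absProd_nonneg w i j)
    (Finset.mem_univ j)).trans (row_le_sum (absProd_nonneg w) i)).trans hw

/-- The integrals of `𝔼|U||W|` over the intervals of the uniform grid. -/
def stepMean (ρ : ℝ → Measure (Weights D m)) (L l : ℕ) : Matrix (Fin D) (Fin D) ℝ :=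
  Matrix.of fun i j => ∫ s in ((l : ℝ) / L)..(((l + 1 : ℕ) : ℝ) / L), meanAbs (ρ s) i j

/-- The weights of the squared errors in the potential. -/
def errWeight (ρ : ℝ → Measure (Weights D m)) (L : ℕ) (p : Fin D → ℝ) (l : ℕ) (i : Fin D) : ℝ :=
  bwd (stepMean ρ L) L p l i / fwd (stepMean ρ L) l i

/-- The potential that is controlled along the layers: a weighted path norm plus a multiple of a
weighted mean squared error. -/
def potential (μ : Measure (Cube d)) (ρ : ℝ → Measure (Weights D m)) (L : ℕ) (p : Fin D → ℝ)
    (lam : ℝ) (z : Cube d → ℝ → Fin D → ℝ) (l : ℕ) (u : Cube d → Fin D → ℝ) (y : Fin D → ℝ) : ℝ :=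
  bwd (stepMean ρ L) L p l ⬝ᵥ y
    + lam * ∑ i, errWeight ρ L p l i * ∫ x, (u x i - z x (l / L) i) ^ 2 ∂μ

theorem stepMean_nonneg (ρ : ℝ → Measure (Weights D m)) (L l : ℕ) (i j : Fin D) :
    0 ≤ stepMean ρ L l i j :=
  intervalIntegral.integral_nonneg (by gcongr; simp) fun _ _ => meanAbs_nonneg i j

theorem Cube.abs_le_one (x : Cube d) (j : Fin d) : |x.1 j| ≤ 1 :=
  abs_le.2 ⟨by linarith [x.2.1 j, show (0 : Fin d → ℝ) j = 0 from rfl], x.2.2 j⟩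

variable {ρ : ℝ → Measure (Weights D m)} {N : ℝ → Fin D → ℝ} {κ M : ℝ}

theorem grid_mem {L l : ℕ} (h : l ≤ L) : (l : ℝ) / L ∈ Icc (0 : ℝ) 1 :=
  ⟨by positivity, div_le_one_of_le₀ (by exact_mod_cast h) (by positivity)⟩

theorem IsBoundedFlow.continuous_state (F : IsBoundedFlow ρ N κ M)
    {z : Cube d → ℝ → Fin D → ℝ} (hz : ∀ x, IsStateSolution ρ x.1 (z x)) {t : ℝ}
    (ht : t ∈ Icc (0 : ℝ) 1) : Continuous fun x => z x t := by
  refine continuous_pi fun i => ?_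
  refine (LipschitzWith.of_dist_le_mul (K := (N t i).toNNReal) fun x x' => ?_).continuous
  rw [Real.coe_toNNReal _ (zero_le_one.trans (F.one_le_norm t ht i)), mul_comm, Real.dist_eq]
  exact F.state_sub_le (hz x) (hz x') (fun j => dist_le_pi_dist x.1 x'.1 j) dist_nonneg t ht i

/-- N is nondecreasing, so freezing it at the left end of each interval only decreases the integral.
The discrete products therefore carry no discretisation loss. -/
theorem IsBoundedFlow.fwd_le (F : IsBoundedFlow ρ N κ M) {L l : ℕ} (h : l ≤ L) (i : Fin D) :
    fwd (stepMean ρ L) l i ≤ N (l / L) i := by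
  induction l generalizing i with
  | zero => simpa [fwd] using F.one_le_norm 0 ⟨le_rfl, zero_le_one⟩ i
  | succ l ih =>
    have ha := grid_mem (Nat.le_of_succ_le h)
    have hb := grid_mem h
    set a : ℝ := (l : ℝ) / L with hadef
    set b : ℝ := ((l + 1 : ℕ) : ℝ) / L with hbdef
    have hab : a ≤ b := by rw [hadef, hbdef]; gcongr; simp
    have hsub : uIcc a b ⊆ uIcc (0 : ℝ) 1 := by
      rw [uIcc_of_le (zero_le_one' ℝ)]; exact ordConnected_Icc.uIcc_subset ha hb
    have hI : ∀ i j, IntervalIntegrable (fun t => meanAbs (ρ t) i j) volume a b := fun i j =>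
      (F.coeff_integrable i j).mono_set hsub
    rw [solution_sub F.coeff_integrable F.norm.continuousOn F.norm_eq ha hb i]
    refine add_le_add (ih (Nat.le_of_succ_le h) i) ?_
    have h1 : (stepMean ρ L l *ᵥ N a) i = ∫ s in a..b, (meanAbs (ρ s) *ᵥ N a) i := by
      simp only [mulVec_apply]
      rw [intervalIntegral.integral_finsetSum fun j _ => (hI i j).mul_const _]
      simp [intervalIntegral.integral_mul_const, stepMean, hadef, hbdef]
    calc (stepMean ρ L l *ᵥ fwd (stepMean ρ L) l) i ≤ (stepMean ρ L l *ᵥ N a) i := by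
          simp only [mulVec_apply]
          exact Finset.sum_le_sum fun j _ =>
            mul_le_mul_of_nonneg_left (ih (Nat.le_of_succ_le h) j) (stepMean_nonneg ρ L l i j)
      _ = ∫ s in a..b, (meanAbs (ρ s) *ᵥ N a) i := h1
      _ ≤ ∫ s in a..b, (meanAbs (ρ s) *ᵥ N s) i := by
          refine intervalIntegral.integral_mono_on hab ?_
            (intervalIntegrable_mulVec F.coeff_integrable F.norm.continuousOn ha hb i) ?_
          · simp only [mulVec_apply]
            have := IntervalIntegrable.sum (μ := volume) (a := a) (b := b) Finset.univ
              (f := fun (j : Fin D) t => meanAbs (ρ t) i j * N a j) fun j _ =>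
                (hI i j).mul_const _
            simpa [Finset.sum_fn] using this
          · intro s hs
            simp only [mulVec_apply]
            exact Finset.sum_le_sum fun j _ => mul_le_mul_of_nonneg_left
              (F.norm_mono ha.1 hs.1 (hs.2.trans hb.2) j) (meanAbs_nonneg i j)

/-- Integrated form of (b|e₁| − a|e₂|)² ≥ 0; with forward products for a and b it is the cross-term
hypothesis of `weighted_quadratic_step`. -/
theorem two_mul_integral_abs_le {μ : Measure (Cube d)} [IsProbabilityMeasure μ]
    {e₁ e₂ : Cube d → ℝ} (h₁ : Continuous e₁) (h₂ : Continuous e₂) {a b : ℝ} (ha : 0 < a)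
    (hb : 0 < b) : 2 * ∫ x, |e₁ x| * |e₂ x| ∂μ
      ≤ (∫ x, e₁ x ^ 2 ∂μ) * (b / a) + (∫ x, e₂ x ^ 2 ∂μ) * (a / b) := by
  have i1 : Integrable (fun x => e₁ x ^ 2 * (b / a)) μ :=
    (integrable_of_continuous (h₁.pow 2)).mul_const _
  have i2 : Integrable (fun x => e₂ x ^ 2 * (a / b)) μ :=
    (integrable_of_continuous (h₂.pow 2)).mul_const _
  rw [← integral_const_mul, ← integral_mul_const, ← integral_mul_const, ← integral_add i1 i2]
  refine integral_mono ((integrable_of_continuous (h₁.abs.mul h₂.abs)).const_mul _) (i1.add i2)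
    fun x => ?_
  have h : (b * |e₁ x| - a * |e₂ x|) ^ 2 / (a * b)
      = e₁ x ^ 2 * (b / a) + e₂ x ^ 2 * (a / b) - 2 * (|e₁ x| * |e₂ x|) := by
    rw [← sq_abs (e₁ x), ← sq_abs (e₂ x)]
    field_simp
    ring
  have h' : 0 ≤ (b * |e₁ x| - a * |e₂ x|) ^ 2 / (a * b) := by positivity
  change 2 * (|e₁ x| * |e₂ x|) ≤ e₁ x ^ 2 * (b / a) + e₂ x ^ 2 * (a / b)
  linarith

/-- A layer can be appended so that the potential hardly grows. -/
theorem IsBoundedFlow.exists_layer (F : IsBoundedFlow ρ N κ M) {μ : Measure (Cube d)}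
    [IsProbabilityMeasure μ] {z : Cube d → ℝ → Fin D → ℝ}
    (hz : ∀ x, IsStateSolution ρ x.1 (z x)) {L l : ℕ} (hl : l < L) {p : Fin D → ℝ} {τ S lam : ℝ}
    (hτ : 0 < τ) (hp : ∀ i, τ ≤ p i) (hS : p ⬝ᵥ fwd (stepMean ρ L) L ≤ S)
    (hSτ : 2 * S ≤ 24 * M * τ) (hlam : 0 ≤ lam) (hlamL : lam * (725 * κ ^ 2 * M ^ 2) ≤ L)
    {u : Cube d → Fin D → ℝ} {y : Fin D → ℝ} (hu : Continuous u) (huy : ∀ x i, |u x i| ≤ y i)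
    (hpot : potential μ ρ L p lam z l u y ≤ 2 * S) :
    ∃ w : Weights D m, potential μ ρ L p lam z (l + 1)
        (fun x => u x + (1 / (L : ℝ)) • layer w (u x)) ((1 + (1 / (L : ℝ)) • absProd w) *ᵥ y)
      ≤ potential μ ρ L p lam z l u y + S / L := by
  have hL : (0 : ℝ) < L := by exact_mod_cast (Nat.zero_le l).trans_lt hl
  have hM := F.bound_nonneg
  have hκ := F.one_le
  have hA := stepMean_nonneg ρ L
  set A := stepMean ρ L with hAdef
  set h : ℝ := 1 / (L : ℝ) with hh
  have hh0 : 0 < h := by positivity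
  set a : ℝ := (l : ℝ) / L with ha
  set b : ℝ := ((l + 1 : ℕ) : ℝ) / L with hb
  have hab : b - a = h := by rw [ha, hb, hh]; push_cast; ring
  have ha' : a ∈ Icc (0 : ℝ) 1 := grid_mem hl.le
  have hb' : b ∈ Icc (0 : ℝ) 1 := grid_mem hl
  have hp0 : ∀ i, 0 ≤ p i := fun i => hτ.le.trans (hp i)
  have hψ0 : ∀ l i, 0 ≤ bwd A L p l i := fun l i => (hp0 i).trans (le_bwd hA hp0 L l i)
  have hφ1 := one_le_fwd hA
  have hφ0 : ∀ l i, 0 < fwd A l i := fun l i => zero_lt_one.trans_le (hφ1 l i)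
  have hθ0 : ∀ l i, 0 ≤ errWeight ρ L p l i := fun l i => div_nonneg (hψ0 l i) (hφ0 l i).le
  set ψ := bwd A L p (l + 1) with hψ
  set θ := errWeight ρ L p (l + 1) with hθ
  -- Since the forward products are at least 1, ψ/φ ≤ ψ ≤ ψφ entrywise, and the pairing is
  -- conserved.
  have hθS : ∑ i, θ i ≤ S := by
    refine le_trans ?_ ((bwd_dot_fwd (A := A) p (l := l + 1) hl).le.trans hS)
    refine Finset.sum_le_sum fun i _ => ?_
    have := hφ1 (l + 1) i
    exact (div_le_self (hψ0 _ i) this).trans (le_mul_of_one_le_right (hψ0 _ i) this)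
  have hxne : Nonempty (Cube d) := ⟨⟨0, le_rfl, zero_le_one⟩⟩
  have hy0 : ∀ i, 0 ≤ y i := fun i => (abs_nonneg _).trans (huy hxne.some i)
  -- The floor τ ≤ p_i makes the potential control every coordinate of y, including those that α
  -- ignores.
  have hY : ∀ i, y i ≤ 24 * M := by
    intro i
    have h1 : τ * y i ≤ 2 * S := by
      calc τ * y i ≤ bwd A L p l i * y i :=
            mul_le_mul_of_nonneg_right ((hp i).trans (le_bwd hA hp0 L l i)) (hy0 i)
        _ ≤ bwd A L p l ⬝ᵥ y := Finset.single_le_sum (f := fun i => bwd A L p l i * y i)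
            (fun i _ => mul_nonneg (hψ0 l i) (hy0 i)) (Finset.mem_univ i)
        _ ≤ potential μ ρ L p lam z l u y := le_add_of_nonneg_right (mul_nonneg hlam
            (Finset.sum_nonneg fun i _ => mul_nonneg (hθ0 l i)
              (integral_nonneg fun x => sq_nonneg _)))
        _ ≤ 2 * S := hpot
    nlinarith
  have hzc := fun {t} ht => F.continuous_state hz (t := t) ht
  have hzb : ∀ x i, |z x a i| ≤ M := fun x i =>
    (F.state_le (hz x) x.abs_le_one a ha' i).trans (F.norm_le ha' i)
  have hE : ∀ x i, |u x i - z x a i| ≤ 25 * M := fun x i => by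
    have := (abs_sub (u x i) (z x a i)).trans (add_le_add ((huy x i).trans (hY i)) (hzb x i))
    linarith
  have hcb : ∀ x i, |z x b i - z x a i| ≤ κ * M * h := fun x i => by
    rw [← hab]
    exact F.state_increment_le (hz x) x.abs_le_one ha'.1 (by linarith) hb'.2 i
  set c : Fin D → Fin D → ℝ := fun i j => ∫ x, |u x i - z x a i| * |u x j - z x a j| ∂μ with hc
  set q : Fin D → ℝ := fun i => ∫ x, (u x i - z x a i) ^ 2 ∂μ with hq
  have hec : ∀ i, Continuous fun x => u x i - z x a i := fun i =>
    ((continuous_apply i).comp hu).sub ((continuous_apply i).comp (hzc ha'))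
  have hcq : ∀ i j, 2 * c i j ≤ q i * (fwd A l j / fwd A l i) + q j * (fwd A l i / fwd A l j) :=
    fun i j => two_mul_integral_abs_le (hec i) (hec j) (hφ0 l i) (hφ0 l j)
  -- the time at which the law is frozen
  set G : Fin D → Fin D → ℝ := fun i j => ψ i * y j + lam * (θ i * (2 * c i j)) with hG
  obtain ⟨t, ht, hGt⟩ : ∃ t ∈ Icc a b,
      h * (∑ i, ∑ j, G i j * meanAbs (ρ t) i j) ≤ ∑ i, ∑ j, G i j * A l i j := by
    have hsub : uIcc a b ⊆ uIcc (0 : ℝ) 1 := by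
      rw [uIcc_of_le (zero_le_one' ℝ)]; exact ordConnected_Icc.uIcc_subset ha' hb'
    have hI : ∀ i j, IntervalIntegrable (fun t => G i j * meanAbs (ρ t) i j) volume a b :=
      fun i j => ((F.coeff_integrable i j).mono_set hsub).const_mul _
    have hI1 : ∀ i, IntervalIntegrable (fun t => ∑ j, G i j * meanAbs (ρ t) i j) volume a b := by
      intro i
      have := IntervalIntegrable.sum (μ := volume) (a := a) (b := b) Finset.univ
        (f := fun (j : Fin D) t => G i j * meanAbs (ρ t) i j) fun j _ => hI i j
      simpa [Finset.sum_fn] using this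
    have hI2 : IntervalIntegrable (fun t => ∑ i, ∑ j, G i j * meanAbs (ρ t) i j) volume a b := by
      have := IntervalIntegrable.sum (μ := volume) (a := a) (b := b) Finset.univ
        (f := fun (i : Fin D) t => ∑ j, G i j * meanAbs (ρ t) i j) fun i _ => hI1 i
      simpa [Finset.sum_fn] using this
    -- Path-norm growth and error growth are merged in one functional G of the mean matrix, so a
    -- single time serves both.
    obtain ⟨t, ht, h1⟩ := exists_le_interval_average (by linarith : a < b) hI2
    refine ⟨t, ht, hab ▸ h1.trans (le_of_eq ?_)⟩
    rw [intervalIntegral.integral_finsetSum fun i _ => hI1 i]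
    refine Finset.sum_congr rfl fun i _ => ?_
    rw [intervalIntegral.integral_finsetSum fun j _ => hI i j]
    refine Finset.sum_congr rfl fun j _ => ?_
    rw [intervalIntegral.integral_const_mul]
    rfl
  have ht' : t ∈ Icc (0 : ℝ) 1 := ⟨ha'.1.trans ht.1, ht.2.trans hb'.2⟩
  have := F.isProb t ht'
  obtain ⟨ν, hν, hνm, hνA, hνd⟩ := exists_reweighted (F.lip.integrable t ht')
  replace hνm : ∀ᵐ w ∂ν, ∑ i, ∑ j, absProd w i j ≤ κ :=
    hνm.mono fun w hw => hw.trans (F.mass_le t ht')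
  have hνi := integrable_absProd_of_mass_le hνm
  have herr := fun i => expected_error_le (μ := μ) (c := fun x => z x b - z x a) hνm hνi
    (hzc ha') hu ((hzc hb').sub (hzc ha')) hh0.le (by positivity : 0 ≤ 24 * M)
    (fun x i => (huy x i).trans (hY i)) hE hcb (fun x i => by
      rw [hνd, ← hab]
      exact F.euler_consistent (hz x) x.abs_le_one ha'.1 (by linarith) hb'.2 ht i) i
  rw [hνA] at herr
  set J : Weights D m → Fin D → ℝ := fun w i =>
    ∫ x, (u x i + h * layer w (u x) i - z x a i - (z x b - z x a) i) ^ 2 ∂μ with hJ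
  have hJi : ∀ i, Integrable (fun w => J w i) ν := fun i => (herr i).1
  -- With E = 25M, β = 2κ²Mh², Y = 24M and b = κMh, the remainder is 2Eβ + (25κMh)² = (100 +
  -- 625)κ²M²h².
  have hJb : ∀ i, ∫ w, J w i ∂ν
      ≤ q i + h * ∑ j, meanAbs (ρ t) i j * (2 * c i j) + 725 * κ ^ 2 * M ^ 2 * h ^ 2 := by
    intro i
    refine (herr i).2.trans (le_of_eq ?_)
    have e : ∑ j, meanAbs (ρ t) i j * (2 * c i j) = 2 * ∑ j, meanAbs (ρ t) i j * c i j := by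
      rw [Finset.mul_sum]; exact Finset.sum_congr rfl fun j _ => by ring
    rw [e, hab]
    simp only [hc, hq]
    ring
  have hpi : ∀ i j, Integrable (fun w => ψ i * (absProd w i j * y j)) ν := fun i j =>
    ((hνi i j).mul_const _).const_mul _
  set H : Weights D m → ℝ := fun w =>
    ψ ⬝ᵥ y + h * (∑ i, ∑ j, ψ i * (absProd w i j * y j)) + lam * ∑ i, θ i * J w i with hH
  have hi1 : Integrable (fun w => h * (∑ i, ∑ j, ψ i * (absProd w i j * y j))) ν :=
    (integrable_finsetSum _ fun i _ => integrable_finsetSum _ fun j _ => hpi i j).const_mul _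
  have hi2 : Integrable (fun w => ψ ⬝ᵥ y + h * (∑ i, ∑ j, ψ i * (absProd w i j * y j))) ν :=
    (integrable_const _).add hi1
  have hi3 : Integrable (fun w => lam * ∑ i, θ i * J w i) ν :=
    (integrable_finsetSum _ fun i _ => (hJi i).const_mul _).const_mul _
  have hHint : Integrable H ν := hi2.add hi3
  -- Some weights do no worse than the mean. H, shown next to be the new potential, contains path
  -- norm and error together, so one choice suits both.
  obtain ⟨w, hw⟩ := exists_le_integral hHint
  refine ⟨w, ?_⟩
  have hHw : potential μ ρ L p lam z (l + 1) (fun x => u x + h • layer w (u x))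
      ((1 + h • absProd w) *ᵥ y) = H w := by
    unfold potential
    rw [hH]
    congr 1
    · rw [Matrix.add_mulVec, Matrix.one_mulVec, dotProduct_add, Matrix.smul_mulVec,
        dotProduct_smul, smul_eq_mul]
      congr 2
      simp only [dotProduct, mulVec_apply, Finset.mul_sum]
      rfl
    · congr 1
      refine Finset.sum_congr rfl fun i _ => ?_
      congr 1
      refine integral_congr_ae (ae_of_all _ fun x => ?_)
      simp only [Pi.add_apply, Pi.smul_apply, Pi.sub_apply, smul_eq_mul, ← hb]
      ring
  have hHi : ∫ w, H w ∂ν = ψ ⬝ᵥ y + h * (∑ i, ∑ j, ψ i * (meanAbs (ρ t) i j * y j))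
      + lam * ∑ i, θ i * ∫ w, J w i ∂ν := by
    rw [← hνA]
    simp only [hH]
    rw [integral_add hi2 hi3, integral_add (integrable_const _) hi1, integral_const_mul,
      integral_const_mul, integral_finsetSum _ fun i _ => (hJi i).const_mul _,
      integral_finsetSum _ fun i _ => integrable_finsetSum _ fun j _ => hpi i j]
    simp only [integral_const_mul]
    congr 1
    congr 1
    · simp
    · congr 1
      refine Finset.sum_congr rfl fun i _ => ?_
      rw [integral_finsetSum _ fun j _ => hpi i j]
      simp [integral_const_mul, integral_mul_const, meanAbs]
  have hstep := weighted_quadratic_step (hA l) (hψ0 (l + 1)) (hφ0 l)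
    (a := q) (fun i => integral_nonneg fun x => sq_nonneg _) hcq
  have hbwd : bwd A L p l = ψ + ψ ᵥ* A l := bwd_eq hl p
  have hmain : ∑ i, θ i * ∫ w, J w i ∂ν ≤ ∑ i, θ i * q i
      + h * (∑ i, ∑ j, θ i * (2 * c i j) * meanAbs (ρ t) i j)
      + S * (725 * κ ^ 2 * M ^ 2 * h ^ 2) := by
    calc ∑ i, θ i * ∫ w, J w i ∂ν
        ≤ ∑ i, θ i * (q i + h * ∑ j, meanAbs (ρ t) i j * (2 * c i j)
          + 725 * κ ^ 2 * M ^ 2 * h ^ 2) :=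
          Finset.sum_le_sum fun i _ => mul_le_mul_of_nonneg_left (hJb i) (hθ0 _ i)
      _ = ∑ i, θ i * q i + h * (∑ i, ∑ j, θ i * (2 * c i j) * meanAbs (ρ t) i j)
          + (∑ i, θ i) * (725 * κ ^ 2 * M ^ 2 * h ^ 2) := by
          rw [Finset.sum_mul, Finset.mul_sum, ← Finset.sum_add_distrib, ← Finset.sum_add_distrib]
          refine Finset.sum_congr rfl fun i _ => ?_
          simp only [mul_add, Finset.mul_sum]
          congr 2
          exact Finset.sum_congr rfl fun j _ => by ring
      _ ≤ _ := by gcongr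
  have hsplit : ∀ B : Matrix (Fin D) (Fin D) ℝ, ∑ i, ∑ j, G i j * B i j
      = ∑ i, ∑ j, ψ i * (B i j * y j) + lam * ∑ i, ∑ j, θ i * (2 * c i j) * B i j := by
    intro B
    simp only [hG, Finset.mul_sum, ← Finset.sum_add_distrib]
    exact Finset.sum_congr rfl fun i _ => Finset.sum_congr rfl fun j _ => by ring
  have hpath : bwd A L p l ⬝ᵥ y = ψ ⬝ᵥ y + ∑ i, ∑ j, ψ i * (A l i j * y j) := by
    rw [hbwd, add_dotProduct, ← Matrix.dotProduct_mulVec]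
    simp only [dotProduct, mulVec_apply, Finset.mul_sum]
  -- The adjoint step with B = A_l turns the weights of layer l + 1 and all cross terms into the
  -- weights of layer l.
  have hquad : ∑ i, θ i * q i + ∑ i, ∑ j, θ i * (2 * c i j) * A l i j
      ≤ ∑ i, errWeight ρ L p l i * q i := by
    have e1 : ∑ i, θ i * q i + ∑ i, ∑ j, θ i * (2 * c i j) * A l i j
        = ∑ i, ψ i / (fwd A l + A l *ᵥ fwd A l) i * (q i + 2 * ∑ j, A l i j * c i j) := by
      rw [← Finset.sum_add_distrib]
      refine Finset.sum_congr rfl fun i _ => ?_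
      change _ = θ i * _
      rw [mul_add, Finset.mul_sum, Finset.mul_sum]
      congr 1
      exact Finset.sum_congr rfl fun j _ => by ring
    rw [e1]
    refine hstep.trans (le_of_eq ?_)
    rw [← hψ, ← hbwd]
    rfl
  have hfin : lam * (S * (725 * κ ^ 2 * M ^ 2 * h ^ 2)) ≤ S / L := by
    have hS0 : 0 ≤ S := (Finset.sum_nonneg fun i _ => hθ0 _ i).trans hθS
    have e1 : lam * (S * (725 * κ ^ 2 * M ^ 2 * h ^ 2))
        = lam * (725 * κ ^ 2 * M ^ 2) * (S * h ^ 2) := by ring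
    have e2 : (L : ℝ) * (S * h ^ 2) = S / L := by rw [hh]; field_simp
    rw [e1, ← e2]
    exact mul_le_mul_of_nonneg_right hlamL (by positivity)
  have hpot' : potential μ ρ L p lam z l u y
      = bwd A L p l ⬝ᵥ y + lam * ∑ i, errWeight ρ L p l i * q i := rfl
  rw [hHw, hpot', hpath]
  refine hw.trans ?_
  rw [hHi]
  have g1 := mul_le_mul_of_nonneg_left hmain hlam
  have g2 := mul_le_mul_of_nonneg_left hquad hlam
  rw [hsplit, hsplit] at hGt
  rw [mul_add] at g1 g2 hGt
  rw [mul_add] at g1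
  linarith

end Step

/-! ### Building the network and reading off both bounds -/

section Approximation

variable {d D m : ℕ} {ρ : ℝ → Measure (Weights D m)} {N : ℝ → Fin D → ℝ} {κ M : ℝ}

/-- Layers can be chosen one after the other so that the potential stays bounded. -/
theorem IsBoundedFlow.exists_layers (F : IsBoundedFlow ρ N κ M) {μ : Measure (Cube d)}
    [IsProbabilityMeasure μ] {z : Cube d → ℝ → Fin D → ℝ}
    (hz : ∀ x, IsStateSolution ρ x.1 (z x)) {L : ℕ} {p : Fin D → ℝ} {τ S lam : ℝ}
    (hτ : 0 < τ) (hp : ∀ i, τ ≤ p i) (hS : p ⬝ᵥ fwd (stepMean ρ L) L ≤ S)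
    (hSτ : 2 * S ≤ 24 * M * τ) (hlam : 0 ≤ lam) (hlamL : lam * (725 * κ ^ 2 * M ^ 2) ≤ L)
    {l : ℕ} (hl : l ≤ L) :
    ∃ ws : Fin l → Weights D m,
      let u : Cube d → Fin D → ℝ := fun x =>
        Fin.foldl l (fun z k => z + (1 / (L : ℝ)) • layer (ws k) z) (inputMatrix d D *ᵥ x.1)
      let y : Fin D → ℝ :=
        Fin.foldl l (fun y k => (1 + (1 / (L : ℝ)) • absProd (ws k)) *ᵥ y) (fun _ => (1 : ℝ))
      Continuous u ∧ (∀ x i, |u x i| ≤ y i) ∧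
        potential μ ρ L p lam z l u y ≤ S + l * (S / L) := by
  have hA := stepMean_nonneg ρ L
  have hS0 : 0 ≤ S := (Finset.sum_nonneg fun i _ => mul_nonneg (hτ.le.trans (hp i))
    (zero_le_one.trans (one_le_fwd hA L i))).trans hS
  induction l with
  | zero =>
    refine ⟨fun k => k.elim0, ?_, ?_, ?_⟩
    · simp only [Fin.foldl_zero]
      fun_prop
    · intro x i
      simpa using abs_inputMatrix_mulVec_le D x.1 x.abs_le_one zero_le_one i
    · have h0 : ∀ x, z x 0 = inputMatrix d D *ᵥ x.1 := fun x => by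
        ext i
        simpa using (hz x).eq_integral 0 ⟨le_rfl, zero_le_one⟩ i
      -- Network and flow start at the same point, so the initial potential is just the conserved
      -- pairing, at most S.
      have h1 := bwd_dot_fwd (A := stepMean ρ L) p (Nat.zero_le L)
      simp only [fwd] at h1
      simp only [potential, Fin.foldl_zero, Nat.cast_zero, zero_div, h0, sub_self, zero_mul,
        add_zero]
      simpa [h1] using hS
  | succ l ih =>
    obtain ⟨ws, hu, huy, hpot⟩ := ih (Nat.le_of_succ_le hl)
    have hL : (0 : ℝ) < L := by exact_mod_cast (Nat.zero_lt_succ l).trans_le hl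
    -- The increments never add up to more than S, so the a priori bound 2S that `exists_layer`
    -- needs persists.
    have h2S : S + l * (S / L) ≤ 2 * S := by
      have : (l : ℝ) * (S / L) ≤ L * (S / L) := by
        have : (l : ℝ) ≤ L := by exact_mod_cast Nat.le_of_succ_le hl
        gcongr
      rw [mul_div_cancel₀ _ hL.ne'] at this
      linarith
    obtain ⟨w, hw⟩ := F.exists_layer hz hl hτ hp hS hSτ hlam hlamL hu huy (hpot.trans h2S)
    refine ⟨Fin.snoc ws w, ?_⟩
    simp only [Fin.foldl_succ_last, Fin.snoc_castSucc, Fin.snoc_last]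
    refine ⟨?_, ?_, ?_⟩
    · refine continuous_pi fun i => ((continuous_apply i).comp hu).add ?_
      exact continuous_const.mul ((continuous_layer i).comp (continuous_const.prodMk hu))
    · intro x i
      rw [Matrix.add_mulVec, Matrix.one_mulVec, Matrix.smul_mulVec]
      simp only [Pi.add_apply, Pi.smul_apply, smul_eq_mul, mulVec_apply]
      refine (abs_add_le _ _).trans (add_le_add (huy x i) ?_)
      rw [abs_mul, abs_of_nonneg (by positivity : 0 ≤ 1 / (L : ℝ))]
      refine mul_le_mul_of_nonneg_left ((abs_layer_le _ _ i).trans ?_) (by positivity)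
      exact Finset.sum_le_sum fun j _ =>
        mul_le_mul_of_nonneg_left (huy x j) (absProd_nonneg w i j)
    · refine hw.trans ((add_le_add_left hpot _).trans (le_of_eq ?_))
      push_cast
      ring

/-- Cauchy-Schwarz, splitting a_i²e_i² as |a_i|φ_i times (|a_i|/φ_i)e_i². The second factor matches
the error weights at the last layer. -/
theorem sq_dotProduct_le {a e φ : Fin D → ℝ} (hφ : ∀ i, 0 < φ i) :
    (a ⬝ᵥ e) ^ 2 ≤ (absVec a ⬝ᵥ φ) * ∑ i, |a i| / φ i * e i ^ 2 := by
  refine Finset.sum_sq_le_sum_mul_sum_of_sq_le_mul _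
    (fun i _ => mul_nonneg (abs_nonneg _) (hφ i).le)
    (fun i _ => mul_nonneg (div_nonneg (abs_nonneg _) (hφ i).le) (sq_nonneg _)) fun i _ => ?_
  have := (hφ i).ne'
  refine le_of_eq ?_
  rw [mul_pow, ← sq_abs (a i)]
  simp only [absVec]
  field_simp

theorem l2Norm_sq (μ : Measure (Cube d)) (g : Cube d → ℝ) : l2Norm μ g ^ 2 = ∫ x, g x ^ 2 ∂μ := by
  rw [l2Norm, Real.sq_sqrt (integral_nonneg fun x => by positivity)]
  simp

theorem IsBoundedFlow.card_le (F : IsBoundedFlow ρ N κ M) : (D : ℝ) ≤ ∑ i, N 1 i := by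
  simpa using Finset.sum_le_sum fun i (_ : i ∈ Finset.univ) =>
    F.one_le_norm 1 ⟨zero_le_one, le_rfl⟩ i

theorem IsBoundedFlow.absVec_dot_nonneg (F : IsBoundedFlow ρ N κ M) (α : Fin D → ℝ) :
    0 ≤ absVec α ⬝ᵥ N 1 :=
  Finset.sum_nonneg fun i _ => mul_nonneg (abs_nonneg _)
    (zero_le_one.trans (F.one_le_norm 1 ⟨zero_le_one, le_rfl⟩ i))

/-- A bounded flow is approximated by residual networks of controlled path norm. -/
theorem IsBoundedFlow.exists_resNet (F : IsBoundedFlow ρ N κ M) (μ : Measure (Cube d))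
    [IsProbabilityMeasure μ] {z : Cube d → ℝ → Fin D → ℝ}
    (hz : ∀ x, IsStateSolution ρ x.1 (z x)) {α : Fin D → ℝ} {T : ℝ} (hT : 0 < T) (hM : 0 < M)
    (hα : absVec α ⬝ᵥ N 1 ≤ 11 / 10 * T) {L : ℕ} (hL : 0 < L) {lam : ℝ} (hlam : 0 < lam)
    (hlamL : lam * (725 * κ ^ 2 * M ^ 2) ≤ L) :
    ∃ Θ : ResNet D m L, l2Norm μ (fun x => α ⬝ᵥ z x 1 - Θ.toFun x) ^ 2 ≤ 3 * T ^ 2 / lam ∧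
      Θ.pathNorm ≤ 9 * T := by
  have hL' : (0 : ℝ) < L := by exact_mod_cast hL
  have hLL : (L : ℝ) / L = 1 := div_self hL'.ne'
  have h1 : (1 : ℝ) ∈ Icc (0 : ℝ) 1 := ⟨zero_le_one, le_rfl⟩
  -- Replacing |α| by p adds at most τM = T/10 to the pairing, so S = 11T/10 + T/10 = 6T/5; then
  -- 24Mτ = 2S exactly.
  set τ : ℝ := T / (10 * M) with hτ
  have hτ0 : 0 < τ := by positivity
  set p : Fin D → ℝ := fun i => |α i| + τ with hp
  set φ := fwd (stepMean ρ L) L with hφ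
  have hφ1 : ∀ i, 1 ≤ φ i := one_le_fwd (stepMean_nonneg ρ L) L
  have hφ0 : ∀ i, 0 < φ i := fun i => zero_lt_one.trans_le (hφ1 i)
  have hφN : ∀ i, φ i ≤ N 1 i := fun i => hLL ▸ F.fwd_le le_rfl i
  have hαφ : absVec α ⬝ᵥ φ ≤ 11 / 10 * T := (Finset.sum_le_sum fun i _ =>
    mul_le_mul_of_nonneg_left (hφN i) (abs_nonneg _)).trans hα
  have hS : p ⬝ᵥ φ ≤ 6 / 5 * T := by
    have e : p ⬝ᵥ φ = absVec α ⬝ᵥ φ + τ * ∑ i, φ i := by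
      simp only [hp, dotProduct, absVec, add_mul, Finset.sum_add_distrib, Finset.mul_sum]
    have e2 : τ * ∑ i, φ i ≤ τ * M :=
      mul_le_mul_of_nonneg_left ((Finset.sum_le_sum fun i _ => hφN i).trans F.sum_le) hτ0.le
    have e3 : τ * M = T / 10 := by rw [hτ]; field_simp
    linarith
  have hSτ : 2 * (6 / 5 * T) ≤ 24 * M * τ := by
    have : 24 * M * τ = 2 * (6 / 5 * T) := by rw [hτ]; field_simp; norm_num
    rw [this]
  obtain ⟨ws, hu, huy, hpot⟩ := F.exists_layers (μ := μ) hz hτ0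
    (fun i => le_add_of_nonneg_left (abs_nonneg (α i)) : ∀ i, τ ≤ p i) hS hSτ hlam.le hlamL le_rfl
  set u : Cube d → Fin D → ℝ := fun x =>
    Fin.foldl L (fun z k => z + (1 / (L : ℝ)) • layer (ws k) z) (inputMatrix d D *ᵥ x.1) with hudef
  set y : Fin D → ℝ :=
    Fin.foldl L (fun y k => (1 + (1 / (L : ℝ)) • absProd (ws k)) *ᵥ y) (fun _ => (1 : ℝ))
    with hydef
  have hy0 : ∀ i, 0 ≤ y i := fun i => (abs_nonneg _).trans (huy ⟨0, le_rfl, zero_le_one⟩ i)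
  set V : ℝ := ∑ i, p i / φ i * ∫ x, (u x i - z x 1 i) ^ 2 ∂μ with hV
  have hp0 : ∀ i, 0 ≤ p i := fun i => by positivity
  have hV0 : 0 ≤ V := Finset.sum_nonneg fun i _ =>
    mul_nonneg (div_nonneg (hp0 i) (hφ0 i).le) (integral_nonneg fun x => sq_nonneg _)
  have hpot' : p ⬝ᵥ y + lam * V ≤ 12 / 5 * T := by
    have e : potential μ ρ L p lam z L u y = p ⬝ᵥ y + lam * V := by
      simp only [potential, errWeight, bwd_self, hLL, hV, hφ]
    rw [← e]
    refine hpot.trans (le_of_eq ?_)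
    rw [mul_div_cancel₀ _ hL'.ne']
    ring
  have hpy0 : 0 ≤ p ⬝ᵥ y := Finset.sum_nonneg fun i _ => mul_nonneg (hp0 i) (hy0 i)
  refine ⟨⟨ws, α⟩, ?_, ?_⟩
  · have hec : ∀ i, Continuous fun x => (u x i - z x 1 i) ^ 2 := fun i =>
      (((continuous_apply i).comp hu).sub
        ((continuous_apply i).comp (F.continuous_state hz h1))).pow 2
    have hei : ∀ i, Integrable (fun x => p i / φ i * (u x i - z x 1 i) ^ 2) μ := fun i =>
      (integrable_of_continuous (hec i)).const_mul _
    have hpt : ∀ x, (α ⬝ᵥ z x 1 - (⟨ws, α⟩ : ResNet D m L).toFun x) ^ 2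
        ≤ 11 / 10 * T * ∑ i, p i / φ i * (u x i - z x 1 i) ^ 2 := by
      intro x
      have e : α ⬝ᵥ z x 1 - (⟨ws, α⟩ : ResNet D m L).toFun x = -(α ⬝ᵥ (u x - z x 1)) := by
        rw [dotProduct_sub, neg_sub]; rfl
      rw [e, neg_sq]
      refine (sq_dotProduct_le hφ0).trans ?_
      refine mul_le_mul hαφ (Finset.sum_le_sum fun i _ => ?_) (Finset.sum_nonneg fun i _ =>
        mul_nonneg (div_nonneg (abs_nonneg _) (hφ0 i).le) (sq_nonneg _)) (by positivity)
      refine mul_le_mul_of_nonneg_right ?_ (sq_nonneg _)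
      exact div_le_div_of_nonneg_right (le_add_of_nonneg_right hτ0.le) (hφ0 i).le
    rw [l2Norm_sq]
    calc ∫ x, (α ⬝ᵥ z x 1 - (⟨ws, α⟩ : ResNet D m L).toFun x) ^ 2 ∂μ
        ≤ ∫ x, 11 / 10 * T * ∑ i, p i / φ i * (u x i - z x 1 i) ^ 2 ∂μ :=
          integral_mono_of_nonneg (ae_of_all _ fun x => sq_nonneg _)
            ((integrable_finsetSum _ fun i _ => hei i).const_mul _) (ae_of_all _ hpt)
      _ = 11 / 10 * T * V := by
          rw [integral_const_mul, integral_finsetSum _ fun i _ => hei i]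
          simp only [integral_const_mul, hV]
      -- The final potential gives `lam` · V ≤ 12T/5, and 11/10 · 12/5 = 66/25 ≤ 3.
      _ ≤ 3 * T ^ 2 / lam := by
          rw [le_div_iff₀ hlam]
          nlinarith
  · change absVec α ⬝ᵥ y ≤ 9 * T
    have : absVec α ⬝ᵥ y ≤ p ⬝ᵥ y := Finset.sum_le_sum fun i _ =>
      mul_le_mul_of_nonneg_right (le_add_of_nonneg_right hτ0.le) (hy0 i)
    have := mul_nonneg hlam.le hV0
    linarith

/-! ### Constants from the Lipschitz norm and the minimal depth -/

theorem IsLipBound.mono {K K' : ℝ} (h : IsLipBound ρ K) (hK : K ≤ K') : IsLipBound ρ K' where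
  integrable := h.integrable
  drift_le t ht s hs z := (h.drift_le t ht s hs z).trans (by
    have : 0 ≤ eNorm z := Real.sqrt_nonneg _
    gcongr)
  mass_le t ht s hs := (h.mass_le t ht s hs).trans (by gcongr)

/-- An admissible K < l₀ + 1 is taken, which avoids asking whether the infimum is attained. The mass
is at most l₀ at time 0 and drifts by at most K, whence 2l₀ + 1. -/
theorem bounds_of_lipNorm_le {l₀ : ℝ≥0} (h : lipNorm ρ ≤ l₀) :
    IsLipBound ρ (2 * (l₀ : ℝ) + 1) ∧ ∀ t ∈ Icc (0 : ℝ) 1, meanMass (ρ t) ≤ 2 * (l₀ : ℝ) + 1 := by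
  have h0 : meanMass (ρ 0) ≤ l₀ := by
    have : ENNReal.ofReal (meanMass (ρ 0)) ≤ l₀ := le_self_add.trans h
    rwa [ENNReal.ofReal_le_iff_le_toReal ENNReal.coe_ne_top, ENNReal.coe_toReal] at this
  have h1 : lipCoeff ρ < ((l₀ + 1 : ℝ≥0) : ℝ≥0∞) :=
    (le_add_self.trans h).trans_lt (by exact_mod_cast lt_add_one l₀)
  simp only [lipCoeff, iInf_lt_iff] at h1
  obtain ⟨K, hK, hK'⟩ := h1
  have hK'' : (K : ℝ) < l₀ + 1 := by exact_mod_cast hK'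
  have hl : (0 : ℝ) ≤ l₀ := l₀.2
  refine ⟨hK.mono (by linarith), fun t ht => ?_⟩
  have h2 := (abs_le.1 (hK.mass_le t ht 0 ⟨le_rfl, zero_le_one⟩)).2
  have h3 : (K : ℝ) * |t - 0| ≤ K := by
    rw [sub_zero, abs_of_nonneg ht.1]
    exact mul_le_of_le_one_right K.2 ht.2
  linarith

/-- The minimal depth, as a polynomial in `D`, `m`, `l₀` and the norm. -/
def depthPoly (k : ℕ) : MvPolynomial (Fin 4) ℝ :=
  (1 + MvPolynomial.C 725 * (2 * MvPolynomial.X 2 + 1) ^ 2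
    * (MvPolynomial.X 0 + 2 * MvPolynomial.X 3) ^ 2) ^ k

theorem eval_depthPoly (k : ℕ) (a b c e : ℝ) :
    MvPolynomial.eval ![a, b, c, e] (depthPoly k)
      = (1 + 725 * (2 * c + 1) ^ 2 * (a + 2 * e) ^ 2) ^ k := by
  simp [depthPoly]

end Approximation

end CompSpace

end

/-! ### The degenerate norm T = 0 and the choice of parameters -/

open CompSpace in
theorem mainTheorem3 (δ : ℝ) (hδ0 : 0 < δ) (hδ1 : δ < 1) :
    ∃ P : MvPolynomial (Fin 4) ℝ,
      ∀ (d D m : ℕ) (_hdD : d ≤ D)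
        (μ : MeasureTheory.Measure (CompSpace.Cube d)) [MeasureTheory.IsProbabilityMeasure μ]
        (f : CompSpace.Cube d → ℝ) (_hf : f ∈ CompSpace.tildeSpace d D m 2)
        (l₀ : ℝ≥0)
        (_hrep : ∀ ε : ℝ, 0 < ε →
          ∃ (α : Fin D → ℝ) (ρ : ℝ → MeasureTheory.Measure (CompSpace.Weights D m)) (c : ℝ),
            CompSpace.Represents f α ρ ∧ CompSpace.IsTildeNormAt 1 α ρ c ∧
            c < CompSpace.tildeNorm D m 1 f + ε ∧ CompSpace.lipNorm ρ ≤ (l₀ : ℝ≥0∞)),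
        ∀ L : ℕ,
          MvPolynomial.eval ![(D : ℝ), (m : ℝ), (l₀ : ℝ), CompSpace.tildeNorm D m 1 f] P ≤ (L : ℝ) →
          ∃ Θ : CompSpace.ResNet D m L,
            CompSpace.l2Norm μ (fun x => f x - Θ.toFun x) ^ 2
                ≤ 3 * CompSpace.tildeNorm D m 1 f ^ 2 / (L : ℝ) ^ (1 - δ) ∧
            Θ.pathNorm ≤ 9 * CompSpace.tildeNorm D m 1 f := by
  refine ⟨depthPoly ⌈1 / δ⌉₊, ?_⟩
  intro d D m _ μ _ f _ l₀ hrep L hL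
  set T := tildeNorm D m 1 f with hT
  set κ : ℝ := 2 * (l₀ : ℝ) + 1 with hκ
  have hκ1 : 1 ≤ κ := by rw [hκ]; linarith [l₀.2]
  have hflow : ∀ ε : ℝ, 0 < ε → ∃ (α : Fin D → ℝ) (ρ : ℝ → Measure (Weights D m))
      (N : ℝ → Fin D → ℝ) (z : Cube d → ℝ → Fin D → ℝ), IsBoundedFlow ρ N κ (∑ i, N 1 i) ∧
      (∀ x, IsStateSolution ρ x.1 (z x)) ∧ (∀ x, f x = α ⬝ᵥ z x 1) ∧
      absVec α ⬝ᵥ N 1 + ∑ i, N 1 i - D < T + ε := by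
    intro ε hε
    obtain ⟨α, ρ, c, ⟨hprob, hrep'⟩, ⟨N, hN, hc⟩, hcT, hlip⟩ := hrep ε hε
    choose z hz _ hfz using hrep'
    obtain ⟨hl, hm⟩ := bounds_of_lipNorm_le hlip
    have F : IsBoundedFlow ρ N κ (∑ i, N 1 i) := ⟨hprob, hl, hN, hm, le_rfl, hκ1⟩
    refine ⟨α, ρ, N, z, F, hz, hfz, ?_⟩
    have e : ∑ i, |N 1 i| = ∑ i, N 1 i := Finset.sum_congr rfl fun i _ =>
      abs_of_nonneg (zero_le_one.trans (F.one_le_norm 1 ⟨zero_le_one, le_rfl⟩ i))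
    rw [← e, ← hc]
    exact hcT
  have hT0 : 0 ≤ T := by
    refine le_of_forall_pos_le_add fun ε hε => ?_
    obtain ⟨α, ρ, N, z, F, -, -, h⟩ := hflow ε hε
    linarith [F.card_le, F.absVec_dot_nonneg α]
  rcases hT0.eq_or_lt with h0 | hTpos
  -- Representations of arbitrarily small norm exist, and |f(x)| ≤ |α|ᵀN(1) for each, so f vanishes
  -- and the network with α = 0 works.
  · have hf0 : ∀ x, f x = 0 := by
      intro x
      refine abs_nonpos_iff.1 (le_of_forall_pos_le_add fun ε hε => ?_)
      obtain ⟨α, ρ, N, z, F, hz, hfz, h⟩ := hflow ε hε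
      have h1 : |f x| ≤ absVec α ⬝ᵥ N 1 := by
        rw [hfz]
        refine (Finset.abs_sum_le_sum_abs _ _).trans (Finset.sum_le_sum fun i _ => ?_)
        rw [abs_mul]
        exact mul_le_mul_of_nonneg_left
          (F.state_le (hz x) x.abs_le_one 1 ⟨zero_le_one, le_rfl⟩ i) (abs_nonneg _)
      linarith [F.card_le]
    refine ⟨⟨fun _ => 0, 0⟩, ?_, ?_⟩
    · simp [l2Norm_sq, hf0, ResNet.toFun, ← h0]
    · have : absVec (0 : Fin D → ℝ) = 0 := by ext i; simp [absVec]
      simp [ResNet.pathNorm, this, ← h0]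
  -- With tolerance T/10, dropping |α|ᵀN(1) ≥ 0 from the norm leaves ‖N(1)‖₁ < D + 11T/10 ≤ M.
  · set M : ℝ := D + 2 * T with hM
    have hMpos : 0 < M := by positivity
    rw [eval_depthPoly, ← hκ, ← hM] at hL
    set Q : ℝ := 725 * κ ^ 2 * M ^ 2 with hQ
    have hQ0 : 0 ≤ Q := by positivity
    have hL1 : (1 : ℝ) ≤ L := (one_le_pow₀ (by linarith)).trans hL
    have hL0 : (0 : ℝ) < L := zero_lt_one.trans_le hL1
    -- From L ≥ (1 + Q)^k with k ≥ 1/δ. The summand 1 keeps the base at least 1, so that powers grow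
    -- with the exponent, and also gives L ≥ 1.
    have hQL : Q ≤ (L : ℝ) ^ δ := by
      calc Q ≤ (1 + Q) ^ (1 : ℝ) := by rw [Real.rpow_one]; linarith
        _ ≤ (1 + Q) ^ ((⌈1 / δ⌉₊ : ℝ) * δ) := by
            refine Real.rpow_le_rpow_of_exponent_le (by linarith) ?_
            rw [← div_le_iff₀ hδ0]
            exact Nat.le_ceil _
        _ = ((1 + Q) ^ ⌈1 / δ⌉₊) ^ δ := by
            rw [Real.rpow_mul (by linarith), Real.rpow_natCast]
        _ ≤ (L : ℝ) ^ δ := Real.rpow_le_rpow (by positivity) hL hδ0.le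
    have hlamL : (L : ℝ) ^ (1 - δ) * Q ≤ L := by
      calc (L : ℝ) ^ (1 - δ) * Q ≤ (L : ℝ) ^ (1 - δ) * (L : ℝ) ^ δ := by gcongr
        _ = L := by rw [← Real.rpow_add hL0, sub_add_cancel, Real.rpow_one]
    obtain ⟨α, ρ, N, z, F, hz, hfz, h⟩ := hflow (T / 10) (by positivity)
    have hc := F.card_le
    have hα := F.absVec_dot_nonneg α
    have F' : IsBoundedFlow ρ N κ M := { F with sum_le := by rw [hM]; linarith }
    simp only [hfz]
    exact F'.exists_resNet μ hz hTpos hMpos (by linarith) (by exact_mod_cast hL0)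
      (Real.rpow_pos_of_pos hL0 _) hlamL
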